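/- **Model.** Let $G$ be a connected undirected graph on the vertex set $\{1,\dots,m\}$, with a player at every vertex. Player $i$ holds $X_i\in\{0,1,\dots,M\}^n$; write $\mathcal X=\sum_{i=1}^m X_i$ for the aggregate vector. All players know $G,n,M,\epsilon$, share an infinite public string of independent fair random bits, and have unbounded computational power. A protocol runs in synchronous rounds; in every round each player may send bits to its neighbours in $G$, computed from its own input, the public string and the messages it received in earlier rounds. The number of bits sent over each edge in each round is fixed in advance. A message is seen only by its recipient. At the end a player fixed in advance outputs a real number. The *max-communication* is the maximum, over the edges of $G$, of the total number of bits sent across the edge in both directions during the execution. The Shannon entropy of $\mathcal X\neq 0$ is $$H(\mathcal X)=\sum_{j=1}^n \frac{|\mathcal X_j|}{\|\mathcal X\|_1}\log\frac{\|\mathcal X\|_1}{|\mathcal X_j|},$$ where $\log$ is the natural logarithm and terms with $\mathcal X_j=0$ are $0$. A protocol *estimates the entropy to within $\epsilon$* if for every choice of inputs with $\mathcal X\ne0$ its output $\tilde H$ satisfies $|\tilde H-H(\mathcal X)|\le\epsilon$ with probability at least $3/4$ over the public string. **Theorem 5.3.** (a) There is an absolute constant $C$ such that for all $n,m,M\in\mathbb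 N$ with $nmM\ge 3$, all $0<\epsilon<1$ and every connected graph $G$ on $m$ vertices there is a protocol on $G$ that estimates the entropy to within $\epsilon$ and has max-communication at most $$\frac{C}{\epsilon^{2}}\Bigl(\log\log (nmM)+\log\frac1\epsilon\Bigr)\ \text{ bits.}$$ (b) In particular, if the number of players and the size of the entries are polynomial in $n$, the bound is $O(\epsilon^{-2}(\log\log n+\log\frac1\epsilon))$: for all real $K,c$ there is a constant $C$ such that for all $n\ge 3$, all $m,M\in\mathbb N$ with $m,M\le K n^c$, all $0<\epsilon<1$ and every connected graph $G$ on $m$ vertices there is a protocol on $G$ that estimates the entropy to within $\epsilon$ and has max-communication at most $$\frac{C}{\epsilon^{2}}\Bigl(\log\log n+\log\frac1\epsilon\Bigr)\ \text{ bits.}$$ -/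

import Mathlib

open MeasureTheory

noncomputable section

namespace MessagePassing

/-- The public random string: an infinite sequence of bits. -/
abbrev Coins : Type := ℕ → Bool

/-- The law of an infinite sequence of independent fair bits. -/
def coinLaw : Measure Coins :=
  Measure.infinitePi (fun _ : ℕ => (PMF.uniformOfFintype Bool).toMeasure)

/-- A public-coin protocol in the message passing model on the communication graph `G`, where every
vertex is a player whose private input has type `I`.

The execution proceeds in synchronous rounds `0, …, rounds - 1`. In round `t` player `u` sends to
player `v` the bit string `msg t u v x ω h`, where `x` is the input of `u`, `ω` is the public random
string, and `h` is what `u` has received so far: a list with one entry per earlier round, the most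
recent one first, each entry telling which string arrived from which player. A message that `u`
sends to `v` enters the view of `v` only.

The number of bits sent in each round over each edge is fixed in advance (`length_msg`), so that no
information is conveyed by the length of a message or by the time at which it is sent; nothing is
ever sent between players that are not adjacent (`len_eq_zero`). After the last round, the
distinguished player `center` outputs a real number, computed from its own input, the public random
string and the messages it received. The players have unbounded computational power. -/
structure Protocol {V : Type} (G : SimpleGraph V) (I : Type) where
  /-- the number of rounds -/
  rounds : ℕ
  /-- `len t u v` is the number of bits that `u` sends to `v` in round `t` -/
  len : ℕ → V → V → ℕ
  len_eq_zero : ∀ t u v, ¬ G.Adj u v → len t u v = 0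
  /-- the message from `u` to `v` in round `t` -/
  msg : ℕ → V → V → I → Coins → List (V → List Bool) → List Bool
  length_msg : ∀ t u v x ω h, (msg t u v x ω h).length = len t u v
  measurableSet_msg : ∀ t u v x h b, MeasurableSet {ω | msg t u v x ω h = b}
  /-- the distinguished player that holds the output -/
  center : V
  /-- the output of the distinguished player -/
  out : I → Coins → List (V → List Bool) → ℝ
  measurable_out : ∀ x h, Measurable (fun ω => out x ω h)

namespace Protocol

variable {V : Type} {G : SimpleGraph V} {I : Type}

/-- `P.view X ω t u` lists the messages that player `u` received in the rounds `0, …, t - 1` (most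
recent round first) when `P` is run on the inputs `X` with the public random string `ω`. -/
def view (P : Protocol G I) (X : V → I) (ω : Coins) : ℕ → V → List (V → List Bool)
  | 0, _ => []
  | t + 1, u => (fun w => P.msg t w u (X w) ω (P.view X ω t w)) :: P.view X ω t u

/-- The output of the protocol on the inputs `X` with the public random string `ω`. -/
def output (P : Protocol G I) (X : V → I) (ω : Coins) : ℝ :=
  P.out (X P.center) ω (P.view X ω P.rounds P.center)

/-- The number of bits sent between `u` and `v`, in both directions, over the whole execution. -/
def edgeBits (P : Protocol G I) (u v : V) : ℕ :=
  ∑ t ∈ Finset.range P.rounds, (P.len t u v + P.len t v u)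

/-- The max-communication: the maximum, over all edges, of the number of bits sent across the edge
during the execution. (Pairs that are not edges contribute `0`.) -/
def maxCommunication [Fintype V] (P : Protocol G I) : ℕ :=
  Finset.univ.sup (fun e : V × V => P.edgeBits e.1 e.2)

end Protocol

/-- The empirical Shannon entropy `∑ⱼ (|xⱼ| / ‖x‖₁) log (‖x‖₁ / |xⱼ|)` of a nonzero vector, with the
natural logarithm; coordinates with `xⱼ = 0` contribute `0`. -/
def shannonEntropy {n : ℕ} (x : Fin n → ℝ) : ℝ :=
  ∑ j, (|x j| / ∑ i, |x i|) * Real.log ((∑ i, |x i|) / |x j|)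

/-- The aggregate vector `∑ᵢ Xᵢ` of the inputs `Xᵢ ∈ {0, …, M}ⁿ` of `m` players. -/
def aggregate {m n M : ℕ} (X : Fin m → Fin n → Fin (M + 1)) (j : Fin n) : ℝ :=
  ∑ i, ((X i j : ℕ) : ℝ)

/-- `P` estimates the Shannon entropy of the aggregate vector up to an additive error of `ε`: on
every tuple of inputs in `{0, …, M}ⁿ` whose aggregate is not the zero vector, the output is within
`ε` of the entropy with probability at least `3/4` over the public random string. -/
def EstimatesEntropy {m n M : ℕ} {G : SimpleGraph (Fin m)}
    (P : Protocol G (Fin n → Fin (M + 1))) (ε : ℝ) : Prop :=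
  ∀ X : Fin m → Fin n → Fin (M + 1), aggregate X ≠ 0 →
    3 / 4 ≤ coinLaw.real {ω | |P.output X ω - shannonEntropy (aggregate X)| ≤ ε}

end MessagePassing

end

/-
A truncated `1`-stable variable `Z ≥ 0` satisfies `E exp (-t Z) ≈ exp (t log t - t log α)`, where
`α` is the truncation level. For the frequencies `p j` of the aggregate vector and independent
copies `Z j` of `Z` this gives `E exp (-∑ p j Z j) ≈ exp (-H - log α)`, so the entropy `H` can be
read off the average of `O(1 / ε ^ 2)` samples of `exp (-∑ p j Z j)`. After discretization of `Z`,
the sums `∑ x j Z j` are linear in the aggregate vector `x` and take integer values, so they can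
be added up along a spanning tree. A player rounds its partial sum to a power of `1 + γ`, upwards
or downwards at random so that the rounding is unbiased; the rounding errors at different players
are uncorrelated, and the relative variance at the root is at most `γ` whatever the shape of the
tree. Sending only the exponents takes `O(log log N)` bits. Since there are finitely many inputs,
the real-valued randomness can be replaced by a uniform choice from a finite sample, which public
coins can make.
-/

noncomputable section

open ProbabilityTheory Filter Topology

namespace MessagePassing

/-! ### Finite samples from public coins -/

theorem ae_tendsto_empirical_frequency {Ω : Type*} [MeasurableSpace Ω] (μ : Measure Ω)
    [IsProbabilityMeasure μ] {B : Set Ω} (hB : MeasurableSet B) :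
    ∀ᵐ ω ∂Measure.infinitePi (fun _ : ℕ => μ),
      Tendsto (fun n : ℕ => (∑ i ∈ Finset.range n, B.indicator (1 : Ω → ℝ) (ω i)) / n) atTop
        (𝓝 (μ.real B)) := by
  have hf : Measurable (B.indicator (1 : Ω → ℝ)) := measurable_one.indicator hB
  have hcoord (i : ℕ) : MeasurePreserving (fun ω : ℕ → Ω => ω i)
      (Measure.infinitePi fun _ => μ) μ := measurePreserving_eval_infinitePi (fun _ => μ) i
  have hindep : iIndepFun (fun (i : ℕ) (ω : ℕ → Ω) => B.indicator (1 : Ω → ℝ) (ω i))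
      (Measure.infinitePi fun _ => μ) :=
    iIndepFun_infinitePi (P := fun _ : ℕ => μ) (X := fun _ => B.indicator 1) fun _ => hf
  have hlaw (i : ℕ) : IdentDistrib (fun ω : ℕ → Ω => B.indicator (1 : Ω → ℝ) (ω i))
      (B.indicator 1) (Measure.infinitePi fun _ => μ) μ :=
    IdentDistrib.comp ⟨(hcoord i).aemeasurable, aemeasurable_id, by
      rw [(hcoord i).map_eq, Measure.map_id]⟩ hf
  rw [← integral_indicator_one hB, ← (hlaw 0).integral_eq]
  exact strong_law_ae_real _
    ((hcoord 0).integrable_comp_of_integrable ((integrable_const (1 : ℝ)).indicator hB))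
    (fun _ _ hij => hindep.indepFun hij) fun i => (hlaw i).trans (hlaw 0).symm

theorem exists_finite_sample {Ω : Type*} [MeasurableSpace Ω] (μ : Measure Ω)
    [IsProbabilityMeasure μ] {ι : Type*} [Finite ι] {A : ι → Set Ω} {p : ℝ}
    (hA : ∀ x, μ.real (A x) < p) :
    ∃ (L : ℕ) (s : (Fin L → Bool) → Ω), ∀ x, (Nat.card {σ // s σ ∈ A x} : ℝ) ≤ p * 2 ^ L := by
  classical
  have hp (x : ι) : μ.real (toMeasurable μ (A x)) < p := by
    simpa only [Measure.real, measure_toMeasurable] using hA x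
  obtain ⟨ω, hω⟩ := (ae_all_iff.2 fun x =>
    ae_tendsto_empirical_frequency μ (measurableSet_toMeasurable μ (A x))).exists
  have hpow : Tendsto (fun L : ℕ => 2 ^ L) atTop (atTop : Filter ℕ) :=
    tendsto_pow_atTop_atTop_of_one_lt one_lt_two
  obtain ⟨L, hL⟩ := (eventually_all.2 fun x =>
    hpow.eventually ((hω x).eventually (gt_mem_nhds (hp x)))).exists
  let e : (Fin L → Bool) ≃ Fin (2 ^ L) := Fintype.equivFinOfCardEq (by simp)
  refine ⟨L, fun σ => ω (e σ), fun x => ?_⟩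
  calc (Nat.card {σ // ω (e σ) ∈ A x} : ℝ) = Nat.card {i : Fin (2 ^ L) // ω i ∈ A x} := by
        exact congrArg _ (Nat.card_congr (e.subtypeEquiv fun _ => Iff.rfl))
    _ = ∑ i : Fin (2 ^ L), if ω i ∈ A x then (1 : ℝ) else 0 := by
        rw [Nat.card_eq_fintype_card, Fintype.card_subtype, ← Finset.sum_boole]
    _ ≤ ∑ i : Fin (2 ^ L), (toMeasurable μ (A x)).indicator 1 (ω i) := by
        refine Finset.sum_le_sum fun i _ => ?_
        split_ifs with hi
        · simp [Set.indicator_of_mem (subset_toMeasurable μ (A x) hi)]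
        · exact Set.indicator_nonneg (fun _ _ => zero_le_one) _
    _ ≤ p * 2 ^ L := by
        have h := hL x
        rw [div_lt_iff₀ (by positivity), Finset.sum_range] at h
        exact_mod_cast h.le

instance : IsProbabilityMeasure coinLaw := by
  unfold coinLaw
  infer_instance

/-- The first `L` public bits. -/
def firstCoins (L : ℕ) (ω : Coins) : Fin L → Bool := fun i => ω i

theorem measurable_firstCoins (L : ℕ) : Measurable (firstCoins L) :=
  measurable_pi_lambda _ fun _ => measurable_pi_apply _

theorem measurableSet_firstCoins {L : ℕ} (p : (Fin L → Bool) → Prop) :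
    MeasurableSet {ω | p (firstCoins L ω)} :=
  measurable_firstCoins L (MeasurableSet.of_discrete (s := {σ | p σ}))

theorem coinLaw_firstCoins_eq (L : ℕ) (σ : Fin L → Bool) :
    coinLaw.real {ω | firstCoins L ω = σ} = (1 / 2) ^ L := by
  have hcylinder : {ω : Coins | firstCoins L ω = σ} =
      Set.pi (Finset.range L) (fun i => if h : i < L then {σ ⟨i, h⟩} else Set.univ) := by
    ext ω
    simp only [Set.mem_ofPred_eq, Set.mem_pi, Finset.coe_range, Set.mem_Iio, funext_iff, firstCoins]
    constructor
    · intro h i hi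
      simp [hi, h ⟨i, hi⟩]
    · intro h i
      simpa [i.2] using h i i.2
  rw [hcylinder, coinLaw, Measure.real,
    Measure.infinitePi_pi _ fun _ _ => MeasurableSet.of_discrete, ENNReal.toReal_prod,
    Finset.prod_congr rfl (g := fun _ => (1 / 2 : ℝ))]
  · simp
  · intro i hi
    rw [dif_pos (Finset.mem_range.1 hi), PMF.toMeasure_apply_singleton _ _ (by simp)]
    simp

theorem coinLaw_firstCoins_mem {L : ℕ} (S : Set (Fin L → Bool)) :
    coinLaw.real {ω | firstCoins L ω ∈ S} = Nat.card S / 2 ^ L := by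
  classical
  have hunion : {ω : Coins | firstCoins L ω ∈ S} = ⋃ σ ∈ S.toFinset, {ω | firstCoins L ω = σ} := by
    ext ω
    simp
  rw [hunion, measureReal_biUnion_finset]
  · simp [coinLaw_firstCoins_eq, div_eq_mul_inv]
  · exact fun σ _ σ' _ hne => Set.disjoint_left.2 fun ω h h' => hne (h.symm.trans h')
  · exact fun σ _ => measurableSet_firstCoins (· = σ)

-- Newman's argument: a finite sample that is representative for every one of the finitely many
-- events `A x` replaces the probability space by finitely many fair coins.
theorem exists_firstCoins_sampler {Ω : Type*} [MeasurableSpace Ω] (μ : Measure Ω)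
    [IsProbabilityMeasure μ] {ι : Type*} [Finite ι] {A : ι → Set Ω} {p : ℝ}
    (hA : ∀ x, μ.real (A x) < p) :
    ∃ (L : ℕ) (s : (Fin L → Bool) → Ω), ∀ x, coinLaw.real {ω | s (firstCoins L ω) ∈ A x} ≤ p := by
  obtain ⟨L, s, hs⟩ := exists_finite_sample μ hA
  refine ⟨L, s, fun x => ?_⟩
  exact (coinLaw_firstCoins_mem {σ | s σ ∈ A x}).trans_le
    ((div_le_iff₀ (by positivity)).2 (hs x))

/-! ### Convergecast on a spanning tree -/

/-- A rooted tree with vertex set `V`, encoded by the parent and the depth of every vertex. The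
parent of the root is a junk value. -/
structure RootedTree (V : Type*) where
  root : V
  parent : V → V
  depth : V → ℕ
  depth_root : depth root = 0
  depth_parent : ∀ u, u ≠ root → depth u = depth (parent u) + 1

theorem exists_spanningTree {V : Type*} {G : SimpleGraph V} (hG : G.Connected) (v : V) :
    ∃ S : RootedTree V, ∀ u, u ≠ S.root → G.Adj u (S.parent u) := by
  have hstep (u : V) (hu : u ≠ v) : ∃ w, G.Adj u w ∧ G.dist u v = G.dist w v + 1 := by
    obtain ⟨p, hp⟩ := hG.exists_walk_length_eq_dist u v
    cases p with
    | nil => exact absurd rfl hu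
    | @cons _ w _ hadj p =>
      refine ⟨w, hadj, ?_⟩
      have hp_le : G.dist w v ≤ p.length := SimpleGraph.dist_le p
      have htriangle : G.dist u v ≤ G.dist u w + G.dist w v := hG.dist_triangle
      have hone : G.dist u w = 1 := SimpleGraph.dist_eq_one_iff_adj.2 hadj
      rw [SimpleGraph.Walk.length_cons] at hp
      omega
  choose! par hpar using hstep
  exact ⟨⟨v, par, fun u => G.dist u v, SimpleGraph.dist_self, fun u hu => (hpar u hu).2⟩,
    fun u hu => (hpar u hu).1⟩

namespace RootedTree

section Children

variable {V : Type*} [Fintype V] (S : RootedTree V)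

/-- The number of levels of the tree strictly below the level of a vertex. -/
def codepth (u : V) : ℕ := Finset.univ.sup S.depth - S.depth u

theorem depth_add_codepth (u : V) : S.depth u + S.codepth u = Finset.univ.sup S.depth :=
  Nat.add_sub_cancel' (Finset.le_sup (Finset.mem_univ u))

variable [DecidableEq V]

/-- The children of a vertex. -/
def children (u : V) : Finset V := {w | w ≠ S.root ∧ S.parent w = u}

variable {S} in
theorem mem_children {u w : V} : w ∈ S.children u ↔ w ≠ S.root ∧ S.parent w = u := by
  simp [children]

variable {S} in
theorem depth_of_mem_children {u w : V} (h : w ∈ S.children u) : S.depth w = S.depth u + 1 := by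
  obtain ⟨hw, rfl⟩ := mem_children.1 h
  exact S.depth_parent w hw

variable {S} in
theorem codepth_of_mem_children {u w : V} (h : w ∈ S.children u) :
    S.codepth u = S.codepth w + 1 := by
  have hdepth := depth_of_mem_children h
  have hu := S.depth_add_codepth u
  have hw := S.depth_add_codepth w
  omega

theorem induction_children {P : V → Prop} (h : ∀ u, (∀ w ∈ S.children u, P w) → P u) (u : V) :
    P u :=
  h u fun w hw =>
    have : S.codepth w < S.codepth u := Nat.lt_of_succ_le (codepth_of_mem_children hw).ge
    induction_children h w
termination_by S.codepth u

/-- The value that a vertex computes from the values of its children, by recursion from the leaves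
to the root. -/
def fold {A : Type*} (step : ∀ u, (S.children u → A) → A) (u : V) : A :=
  step u fun w => fold step w
termination_by S.codepth u
decreasing_by exact Nat.lt_of_succ_le (codepth_of_mem_children w.2).ge

theorem fold_eq {A : Type*} (step : ∀ u, (S.children u → A) → A) (u : V) :
    S.fold step u = step u fun w => S.fold step w := by
  rw [fold]

theorem sum_sum_children (f : V → ℝ) :
    ∑ u, ∑ w ∈ S.children u, f w + f S.root = ∑ w, f w := by
  have hfiber (u : V) :
      S.children u = (Finset.univ.erase S.root).filter fun w => S.parent w = u := by
    ext w
    simp [children]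
  simp_rw [hfiber]
  rw [Finset.sum_fiberwise, Finset.sum_erase_add _ _ (Finset.mem_univ _)]

end Children

end RootedTree

section Convergecast

variable {V : Type} [Fintype V] [DecidableEq V] {G : SimpleGraph V} {I A : Type} {B L : ℕ}

/-- Convergecast on a spanning tree: every player applies `step` to its own input and to the values
received from its children, and sends the result, encoded by `B` bits, to its parent. A vertex at
codepth `t` sends in round `t`, when all its children have reported. -/
def convergecast (S : RootedTree V) (hS : ∀ u, u ≠ S.root → G.Adj u (S.parent u))
    (enc : A → List Bool) (hlen : ∀ a, (enc a).length = B) (dec : List Bool → A)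
    (step : (Fin L → Bool) → ∀ u, I → (S.children u → A) → A) (out : (Fin L → Bool) → A → ℝ) :
    Protocol G I where
  rounds := Finset.univ.sup S.depth
  len t u v := if u ≠ S.root ∧ S.parent u = v ∧ t = S.codepth u then B else 0
  len_eq_zero t u v huv := if_neg fun ⟨hu, hv, _⟩ => huv (hv ▸ hS u hu)
  msg t u v x ω h := if u ≠ S.root ∧ S.parent u = v ∧ t = S.codepth u then
    enc (step (firstCoins L ω) u x fun w => dec (h.headD (fun _ => []) w)) else []
  length_msg t u v x ω h := by split_ifs <;> simp [hlen]
  measurableSet_msg t u v x h b := by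
    split_ifs
    · exact measurableSet_firstCoins
        fun σ => enc (step σ u x fun w => dec (h.headD (fun _ => []) w)) = b
    · exact MeasurableSet.const _
  center := S.root
  out x ω h := out (firstCoins L ω)
    (step (firstCoins L ω) S.root x fun w => dec (h.headD (fun _ => []) w))
  measurable_out x h s _ := measurableSet_firstCoins
    fun σ => out σ (step σ S.root x fun w => dec (h.headD (fun _ => []) w)) ∈ s

variable (S : RootedTree V) (hS : ∀ u, u ≠ S.root → G.Adj u (S.parent u))
  (enc : A → List Bool) (hlen : ∀ a, (enc a).length = B) (dec : List Bool → A)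
  (step : (Fin L → Bool) → ∀ u, I → (S.children u → A) → A) (out : (Fin L → Bool) → A → ℝ)

theorem maxCommunication_convergecast_le :
    (convergecast S hS enc hlen dec step out).maxCommunication ≤ 2 * B := by
  set P := convergecast S hS enc hlen dec step out with hP
  have honce (u v : V) : ∑ t ∈ Finset.range P.rounds, P.len t u v ≤ B :=
    calc ∑ t ∈ Finset.range P.rounds, P.len t u v
        ≤ ∑ t ∈ Finset.range P.rounds, if t = S.codepth u then B else 0 := by
          refine Finset.sum_le_sum fun t _ => ?_
          simp only [hP, convergecast]
          split_ifs <;> omega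
      _ ≤ B := by
          rw [Finset.sum_ite_eq']
          split_ifs <;> simp
  refine Finset.sup_le fun e _ => ?_
  rw [Protocol.edgeBits, Finset.sum_add_distrib]
  have hup := honce e.1 e.2
  have hdown := honce e.2 e.1
  omega

variable {enc dec step}

theorem output_convergecast {X : V → I} {ω : Coins}
    (hdec : ∀ u, dec (enc (S.fold (fun v => step (firstCoins L ω) v (X v)) u)) =
      S.fold (fun v => step (firstCoins L ω) v (X v)) u) :
    (convergecast S hS enc hlen dec step out).output X ω =
      out (firstCoins L ω) (S.fold (fun v => step (firstCoins L ω) v (X v)) S.root) := by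
  set P := convergecast S hS enc hlen dec step out
  set c := S.fold fun v => step (firstCoins L ω) v (X v) with hc
  have hview (u : V) : ∀ w ∈ S.children u,
      dec ((P.view X ω (S.codepth u) u).headD (fun _ => []) w) = c w := by
    induction u using S.induction_children with
    | h u ih =>
      intro w hw
      have hw' := RootedTree.mem_children.1 hw
      rw [RootedTree.codepth_of_mem_children hw]
      change dec (P.msg (S.codepth w) w u (X w) ω (P.view X ω (S.codepth w) w)) = c w
      have hmsg : P.msg (S.codepth w) w u (X w) ω (P.view X ω (S.codepth w) w) = enc (c w) := by
        rw [hc, S.fold_eq, ← hc]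
        refine (if_pos ⟨hw'.1, hw'.2, rfl⟩).trans ?_
        congr 2
        funext v
        exact ih w hw v v.2
      rw [hmsg, hdec]
  have hrounds : P.rounds = S.codepth S.root :=
    (S.depth_add_codepth S.root).symm.trans (by rw [S.depth_root, zero_add])
  rw [Protocol.output, hrounds]
  change out _ (step _ S.root (X S.root) fun w => dec _) = _
  rw [hc, S.fold_eq, ← hc]
  congr 2
  funext w
  exact hview S.root w w.2

end Convergecast

/-! ### Unbiased rounding to a geometric grid -/

section Rounding

/-- The uniform distribution on the unit interval. -/
def unitUniform : Measure ℝ := volume.restrict (Set.Ioc 0 1)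

instance : IsProbabilityMeasure unitUniform := ⟨by simp [unitUniform]⟩

theorem unitUniform_Iio {q : ℝ} (hq₀ : 0 ≤ q) (hq₁ : q ≤ 1) :
    unitUniform.real (Set.Iio q) = q := by
  have hinter : Set.Iio q ∩ Set.Ioc 0 1 = Set.Ioo 0 q := by
    ext x
    simp only [Set.mem_inter_iff, Set.mem_Iio, Set.mem_Ioc, Set.mem_Ioo]
    exact ⟨fun h => ⟨h.2.1, h.1⟩, fun h => ⟨h.2, h.1, h.2.le.trans hq₁⟩⟩
  rw [unitUniform, Measure.real, Measure.restrict_apply measurableSet_Iio, hinter, Real.volume_Ioo]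
  simp [hq₀]

theorem integral_unitUniform_ite {w c : ℝ} (hw : 0 < w) (hc : 0 ≤ c) (hcw : c ≤ w) (y z : ℝ) :
    ∫ θ, (if θ * w < c then y else z) ∂unitUniform = z + (y - z) * (c / w) := by
  have hite (θ : ℝ) : (if θ * w < c then y else z) =
      z + (y - z) * (Set.Iio (c / w)).indicator 1 θ := by
    simp only [Set.indicator_apply, Set.mem_Iio, lt_div_iff₀ hw, Pi.one_apply]
    split_ifs <;> ring
  have hind : Integrable ((Set.Iio (c / w)).indicator (1 : ℝ → ℝ)) unitUniform :=
    (integrable_const (1 : ℝ)).indicator measurableSet_Iio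
  simp_rw [hite]
  rw [integral_add (integrable_const _) (hind.const_mul _), integral_const_mul,
    integral_indicator_one measurableSet_Iio,
    unitUniform_Iio (div_nonneg hc hw.le) ((div_le_one hw).2 hcw)]
  simp

/-- The grid `0, 1, g, g ^ 2, …` to which sums are rounded, indexed by the codes that the players
exchange. -/
def gridValue (g : ℝ) : ℕ → ℝ
  | 0 => 0
  | e + 1 => g ^ e

/-- Randomized rounding of `s` (with `s = 0` or `1 ≤ s`) to one of the two neighbouring points of
the grid, by means of a uniform threshold `θ`. The result is the code of the rounded value. -/
def roundCode (g s θ : ℝ) : ℕ :=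
  if s < 1 then 0
  else if θ * (g ^ (⌊Real.logb g s⌋₊ + 1) - g ^ ⌊Real.logb g s⌋₊) < s - g ^ ⌊Real.logb g s⌋₊ then
    ⌊Real.logb g s⌋₊ + 2
  else ⌊Real.logb g s⌋₊ + 1

theorem measurable_roundCode (g : ℝ) : Measurable fun p : ℝ × ℝ => roundCode g p.1 p.2 := by
  have hexp : Measurable fun p : ℝ × ℝ => ⌊Real.logb g p.1⌋₊ :=
    Nat.measurable_floor.comp ((Real.measurable_log.comp measurable_fst).div_const _)
  have hpow : Measurable fun k : ℕ => g ^ k := measurable_from_top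
  have hlower := hpow.comp hexp
  have hupper := hpow.comp (hexp.add_const 1)
  exact Measurable.ite (measurableSet_lt measurable_fst measurable_const) measurable_const
    (Measurable.ite (measurableSet_lt (measurable_snd.mul (hupper.sub hlower))
      (measurable_fst.sub hlower)) (hexp.add_const 2) (hexp.add_const 1))

theorem roundCode_zero (g θ : ℝ) : roundCode g 0 θ = 0 := if_pos one_pos

variable {g : ℝ} (hg : 1 < g)
include hg

theorem gridValue_nonneg (c : ℕ) : 0 ≤ gridValue g c := by
  cases c with
  | zero => exact le_rfl
  | succ e => exact pow_nonneg (by linarith) e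

theorem gridValue_eq_zero_or (c : ℕ) : gridValue g c = 0 ∨ 1 ≤ gridValue g c := by
  cases c with
  | zero => exact Or.inl rfl
  | succ e => exact Or.inr (one_le_pow₀ hg.le)

theorem pow_floor_logb_le {s : ℝ} (hs : 1 ≤ s) : g ^ ⌊Real.logb g s⌋₊ ≤ s := by
  rw [← Real.rpow_natCast, ← Real.le_logb_iff_rpow_le hg (by linarith)]
  exact Nat.floor_le (Real.logb_nonneg hg hs)

theorem lt_pow_floor_logb_add_one {s : ℝ} (hs : 0 < s) : s < g ^ (⌊Real.logb g s⌋₊ + 1) := by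
  rw [← Real.rpow_natCast, ← Real.logb_lt_iff_lt_rpow hg hs]
  exact_mod_cast Nat.lt_floor_add_one (Real.logb g s)

theorem gridValue_roundCode_le {s : ℝ} (hs : 0 ≤ s) (θ : ℝ) :
    gridValue g (roundCode g s θ) ≤ g * s := by
  unfold roundCode
  split_ifs with hs1 hθ
  · exact mul_nonneg (by linarith) hs
  · change g ^ (_ + 1) ≤ _
    rw [pow_succ']
    exact mul_le_mul_of_nonneg_left (pow_floor_logb_le hg (not_lt.1 hs1)) (by linarith)
  · exact (pow_floor_logb_le hg (not_lt.1 hs1)).trans (le_mul_of_one_le_left hs hg.le)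

theorem le_of_gridValue_lt_pow {c K : ℕ} (hc : gridValue g c < g ^ K) : c ≤ K := by
  cases c with
  | zero => exact Nat.zero_le K
  | succ e => exact (pow_lt_pow_iff_right₀ hg).1 hc

theorem integral_roundCode {s : ℝ} (hs : 1 ≤ s) (f : ℕ → ℝ) :
    ∃ e : ℕ, g ^ e ≤ s ∧ s < g ^ (e + 1) ∧ ∫ θ, f (roundCode g s θ) ∂unitUniform =
      f (e + 1) + (f (e + 2) - f (e + 1)) * ((s - g ^ e) / (g ^ (e + 1) - g ^ e)) := by
  have hlower := pow_floor_logb_le hg hs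
  have hupper := lt_pow_floor_logb_add_one hg (zero_lt_one.trans_le hs)
  refine ⟨_, hlower, hupper, ?_⟩
  rw [← integral_unitUniform_ite (by linarith) (by linarith) (by linarith)]
  simp only [roundCode, if_neg (not_lt.2 hs), apply_ite f]

theorem integral_gridValue_roundCode {s : ℝ} (hs : s = 0 ∨ 1 ≤ s) :
    ∫ θ, gridValue g (roundCode g s θ) ∂unitUniform = s := by
  rcases hs with rfl | hs
  · simp [roundCode_zero, gridValue]
  obtain ⟨e, hlower, hupper, hint⟩ := integral_roundCode hg hs (gridValue g)
  rw [hint]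
  change g ^ e + (g ^ (e + 1) - g ^ e) * _ = s
  rw [mul_div_cancel₀ _ (by linarith : g ^ (e + 1) - g ^ e ≠ 0)]
  ring

-- The variance `(s - g ^ e) * (g ^ (e + 1) - s)` of rounding is at most `(g - 1) * s * (s - v)` for
-- every grid point `v ≤ s`, because `v ≤ g ^ e`.
theorem integral_gridValue_roundCode_sq_le {s : ℝ} (hs : s = 0 ∨ 1 ≤ s) {c : ℕ}
    (hc : gridValue g c ≤ s) :
    ∫ θ, gridValue g (roundCode g s θ) ^ 2 ∂unitUniform ≤
      s ^ 2 + (g - 1) * (s * (s - gridValue g c)) := by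
  rcases hs with rfl | hs
  · simp [roundCode_zero, gridValue]
  obtain ⟨e, hlower, hupper, hint⟩ := integral_roundCode hg hs fun c => gridValue g c ^ 2
  have hgrid : gridValue g c ≤ g ^ e := by
    cases c with
    | zero => exact pow_nonneg (by linarith) e
    | succ k =>
      exact pow_le_pow_right₀ hg.le
        (Nat.lt_succ_iff.1 ((pow_lt_pow_iff_right₀ hg).1 (hc.trans_lt hupper)))
  have hsecond : ∫ θ, gridValue g (roundCode g s θ) ^ 2 ∂unitUniform =
      s ^ 2 + (s - g ^ e) * (g ^ (e + 1) - s) := by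
    have hne : g ^ (e + 1) - g ^ e ≠ 0 := by linarith
    rw [hint]
    change (g ^ e) ^ 2 + ((g ^ (e + 1)) ^ 2 - (g ^ e) ^ 2) * _ = _
    field_simp
    ring
  have hvar : (s - g ^ e) * (g ^ (e + 1) - s) ≤ (s - gridValue g c) * ((g - 1) * s) := by
    refine mul_le_mul (by linarith) ?_ (by linarith) (by linarith)
    rw [pow_succ']
    nlinarith
  linarith

end Rounding

theorem measurePreserving_update {V : Type*} [Fintype V] [DecidableEq V] {X : V → Type*}
    [∀ v, MeasurableSpace (X v)] (μ : ∀ v, Measure (X v)) [∀ v, IsProbabilityMeasure (μ v)]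
    (v : V) :
    MeasurePreserving (fun p : (∀ v, X v) × X v => Function.update p.1 v p.2)
      ((Measure.pi μ).prod (μ v)) (Measure.pi μ) := by
  refine ⟨measurable_update', (Measure.pi_eq fun s hs => ?_).symm⟩
  have hpreimage : (fun p : (∀ v, X v) × X v => Function.update p.1 v p.2) ⁻¹' Set.univ.pi s =
      (Set.univ.pi (Function.update s v Set.univ)) ×ˢ s v := by
    ext ⟨x, y⟩
    simp only [Set.mem_preimage, Set.mem_pi, Set.mem_univ, true_imp_iff, Set.mem_prod]
    constructor
    · intro h
      refine ⟨fun w => ?_, by simpa using h v⟩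
      rcases eq_or_ne w v with rfl | hw
      · simp
      · simpa [Function.update_of_ne hw] using h w
    · rintro ⟨hx, hy⟩ w
      rcases eq_or_ne w v with rfl | hw
      · simpa using hy
      · simpa [Function.update_of_ne hw] using hx w
  rw [Measure.map_apply measurable_update' (MeasurableSet.univ_pi hs), hpreimage,
    Measure.prod_prod, Measure.pi_pi, ← Finset.prod_erase_mul _ _ (Finset.mem_univ v),
    ← Finset.prod_erase_mul _ (fun i => μ i (s i)) (Finset.mem_univ v)]
  simp only [Function.update_self, measure_univ, mul_one]
  refine congrArg (· * _) (Finset.prod_congr rfl fun w hw => ?_)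
  rw [Function.update_of_ne (Finset.ne_of_mem_erase hw)]

theorem integral_eq_integral_update {V : Type*} [Fintype V] [DecidableEq V] {X : V → Type*}
    [∀ v, MeasurableSpace (X v)] (μ : ∀ v, Measure (X v)) [∀ v, IsProbabilityMeasure (μ v)]
    {F : (∀ v, X v) → ℝ} (hF : Integrable F (Measure.pi μ)) (v : V) :
    ∫ θ, F θ ∂Measure.pi μ = ∫ θ, ∫ x, F (Function.update θ v x) ∂μ v ∂Measure.pi μ := by
  have hmp := measurePreserving_update μ v
  rw [← integral_prod (fun p : (∀ v, X v) × X v => F (Function.update p.1 v p.2))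
    (hmp.integrable_comp_of_integrable hF)]
  rw [← integral_map hmp.aemeasurable (f := F) (by rw [hmp.map_eq]; exact hF.1), hmp.map_eq]

theorem sum_eq_zero_or_one_le {ι : Type*} {s : Finset ι} {f : ι → ℝ}
    (hf : ∀ i ∈ s, f i = 0 ∨ 1 ≤ f i) : ∑ i ∈ s, f i = 0 ∨ 1 ≤ ∑ i ∈ s, f i := by
  by_cases hzero : ∀ i ∈ s, f i = 0
  · exact Or.inl (Finset.sum_eq_zero hzero)
  · push Not at hzero
    obtain ⟨i, hi, hfi⟩ := hzero
    refine Or.inr (((hf i hi).resolve_left hfi).trans (Finset.single_le_sum (fun j hj => ?_) hi))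
    exact (hf j hj).elim ge_of_eq zero_le_one.trans

namespace RootedTree

variable {V : Type*} [Fintype V] [DecidableEq V] (S : RootedTree V)

section Code

variable (g : ℝ) (a : V → ℝ)

/-- The codes obtained by summing `a` towards the root, with randomized rounding at every vertex
according to the thresholds `θ`. -/
def code (θ : V → ℝ) : V → ℕ :=
  S.fold fun u f => roundCode g (a u + ∑ w, gridValue g (f w)) (θ u)

/-- The rounded partial sum that a vertex reports to its parent. -/
def rounded (u : V) (θ : V → ℝ) : ℝ := gridValue g (S.code g a θ u)

/-- The partial sum at a vertex before it is rounded. -/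
def partialSum (u : V) (θ : V → ℝ) : ℝ := a u + ∑ w ∈ S.children u, S.rounded g a w θ

theorem code_eq (θ : V → ℝ) (u : V) :
    S.code g a θ u = roundCode g (S.partialSum g a u θ) (θ u) := by
  rw [code, fold_eq, partialSum, ← Finset.sum_coe_sort (S.children u)]
  rfl

theorem rounded_eq (θ : V → ℝ) (u : V) :
    S.rounded g a u θ = gridValue g (roundCode g (S.partialSum g a u θ) (θ u)) := by
  rw [rounded, code_eq]

theorem measurable_code_comp {Ω : Type*} [MeasurableSpace Ω] {a θ : Ω → V → ℝ}
    (ha : Measurable a) (hθ : Measurable θ) (u : V) :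
    Measurable fun ω => S.code g (a ω) (θ ω) u := by
  induction u using S.induction_children with
  | h u ih =>
    simp_rw [code_eq, partialSum]
    refine (measurable_roundCode g).comp (Measurable.prodMk (Measurable.add ?_ ?_) ?_)
    · exact (measurable_pi_apply u).comp ha
    · exact Finset.measurable_fun_sum _ fun w hw =>
        (measurable_from_top (f := gridValue g)).comp (ih w hw)
    · exact (measurable_pi_apply u).comp hθ

theorem measurable_rounded_comp {Ω : Type*} [MeasurableSpace Ω] {a θ : Ω → V → ℝ}
    (ha : Measurable a) (hθ : Measurable θ) (u : V) :
    Measurable fun ω => S.rounded g (a ω) u (θ ω) :=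
  (measurable_from_top (f := gridValue g)).comp (S.measurable_code_comp g ha hθ u)

theorem measurable_rounded (u : V) : Measurable (S.rounded g a u) :=
  S.measurable_rounded_comp g measurable_const measurable_id u

theorem measurable_partialSum (u : V) : Measurable (S.partialSum g a u) :=
  measurable_const.add (Finset.measurable_fun_sum _ fun w _ => S.measurable_rounded g a w)

theorem rounded_update (θ : V → ℝ) (x : ℝ) (u : V) : ∀ v, S.depth v ≤ S.depth u → v ≠ u →
    S.rounded g a u (Function.update θ v x) = S.rounded g a u θ := by
  induction u using S.induction_children with
  | h u ih =>
    intro v hv hvu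
    rw [rounded_eq, rounded_eq, partialSum, partialSum, Function.update_of_ne hvu.symm,
      Finset.sum_congr rfl fun w hw => ?_]
    have := depth_of_mem_children hw
    exact ih w hw v (by omega) (by rintro rfl; omega)

theorem partialSum_update (θ : V → ℝ) (x : ℝ) {u v : V} (hv : S.depth v ≤ S.depth u) :
    S.partialSum g a u (Function.update θ v x) = S.partialSum g a u θ := by
  rw [partialSum, partialSum, Finset.sum_congr rfl fun w hw => ?_]
  have := depth_of_mem_children hw
  exact S.rounded_update g a θ x w v (by omega) (by rintro rfl; omega)

variable {g} in
theorem rounded_nonneg (hg : 1 < g) (u : V) (θ : V → ℝ) : 0 ≤ S.rounded g a u θ :=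
  gridValue_nonneg hg _

end Code

/-- The law of independent uniform thresholds, one for every vertex. -/
abbrev thresholdLaw (V : Type*) [Fintype V] : Measure (V → ℝ) := Measure.pi fun _ : V => unitUniform

section Moments

variable {g : ℝ} {a : V → ℝ} (hg : 1 < g) (ha : ∀ u, a u = 0 ∨ 1 ≤ a u)
include hg ha

theorem partialSum_eq_zero_or (u : V) (θ : V → ℝ) :
    S.partialSum g a u θ = 0 ∨ 1 ≤ S.partialSum g a u θ := by
  rw [partialSum]
  have hnonneg : 0 ≤ ∑ w ∈ S.children u, S.rounded g a w θ :=
    Finset.sum_nonneg fun w _ => S.rounded_nonneg a hg w θ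
  rcases ha u with hu | hu
  · rw [hu, zero_add]
    exact sum_eq_zero_or_one_le fun w _ => gridValue_eq_zero_or hg _
  · exact Or.inr (le_add_of_le_of_nonneg hu hnonneg)

theorem exists_rounded_le (u : V) : ∃ K, ∀ θ, S.rounded g a u θ ≤ K := by
  induction u using S.induction_children with
  | h u ih =>
    choose! K hK using ih
    refine ⟨g * (a u + ∑ w ∈ S.children u, K w), fun θ => ?_⟩
    have hnonneg : 0 ≤ S.partialSum g a u θ := by
      rcases S.partialSum_eq_zero_or hg ha u θ with h | h <;> linarith
    rw [rounded_eq]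
    refine (gridValue_roundCode_le hg hnonneg _).trans
      (mul_le_mul_of_nonneg_left ?_ (by linarith))
    rw [partialSum]
    gcongr with w hw
    exact hK w hw θ

theorem memLp_rounded (u : V) (p : ENNReal) : MemLp (S.rounded g a u) p (thresholdLaw V) := by
  obtain ⟨K, hK⟩ := S.exists_rounded_le hg ha u
  refine MemLp.of_bound (S.measurable_rounded g a u).aestronglyMeasurable K
    (ae_of_all _ fun θ => ?_)
  rw [Real.norm_of_nonneg (S.rounded_nonneg a hg u θ)]
  exact hK θ

theorem memLp_sum_rounded (u : V) (p : ENNReal) :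
    MemLp (fun θ => ∑ w ∈ S.children u, S.rounded g a w θ) p (thresholdLaw V) :=
  memLp_finsetSum _ fun w _ => S.memLp_rounded hg ha w p

theorem memLp_partialSum (u : V) (p : ENNReal) :
    MemLp (S.partialSum g a u) p (thresholdLaw V) :=
  (memLp_const (a u)).add (S.memLp_sum_rounded hg ha u p)

theorem integrable_rounded (u : V) : Integrable (S.rounded g a u) (thresholdLaw V) :=
  memLp_one_iff_integrable.1 (S.memLp_rounded hg ha u 1)

-- Rounding at `u` is unbiased, even given the thresholds of all other vertices.
theorem integral_rounded_mul {u : V} {h : (V → ℝ) → ℝ} (hh : MemLp h 2 (thresholdLaw V))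
    (hinv : ∀ θ x, h (Function.update θ u x) = h θ) :
    ∫ θ, S.rounded g a u θ * h θ ∂thresholdLaw V =
      ∫ θ, S.partialSum g a u θ * h θ ∂thresholdLaw V := by
  rw [integral_eq_integral_update (F := fun θ => S.rounded g a u θ * h θ) (fun _ => unitUniform)
    ((S.memLp_rounded hg ha u 2).integrable_mul hh) u]
  congr 1
  funext θ
  simp_rw [rounded_eq, S.partialSum_update g a _ _ le_rfl, hinv, Function.update_self]
  rw [integral_mul_const, integral_gridValue_roundCode hg (S.partialSum_eq_zero_or hg ha u θ)]

theorem integral_rounded (u : V) :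
    ∫ θ, S.rounded g a u θ ∂thresholdLaw V = ∫ θ, S.partialSum g a u θ ∂thresholdLaw V := by
  simpa using S.integral_rounded_mul hg ha (u := u) (h := fun _ => 1) (memLp_const _)
    fun _ _ => rfl

theorem integral_partialSum (u : V) :
    ∫ θ, S.partialSum g a u θ ∂thresholdLaw V =
      a u + ∑ w ∈ S.children u, ∫ θ, S.rounded g a w θ ∂thresholdLaw V := by
  simp only [partialSum]
  rw [integral_add (integrable_const _)
      (integrable_finsetSum _ fun w _ => S.integrable_rounded hg ha w),
    integral_finsetSum _ fun w _ => S.integrable_rounded hg ha w]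
  simp

theorem integral_rounded_root : ∫ θ, S.rounded g a S.root θ ∂thresholdLaw V = ∑ u, a u := by
  have hchildren := S.sum_sum_children fun w => ∫ θ, S.rounded g a w θ ∂thresholdLaw V
  have hsum : ∑ u, ∫ θ, S.rounded g a u θ ∂thresholdLaw V =
      ∑ u, a u + ∑ u, ∑ w ∈ S.children u, ∫ θ, S.rounded g a w θ ∂thresholdLaw V := by
    rw [← Finset.sum_add_distrib]
    exact Finset.sum_congr rfl fun u _ => by
      rw [S.integral_rounded hg ha, S.integral_partialSum hg ha]
  linarith

theorem integral_rounded_le_parent {u : V} (hu : u ≠ S.root) :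
    ∫ θ, S.rounded g a u θ ∂thresholdLaw V ≤
      ∫ θ, S.rounded g a (S.parent u) θ ∂thresholdLaw V := by
  rw [S.integral_rounded hg ha (S.parent u), S.integral_partialSum hg ha]
  have hnonneg : 0 ≤ a (S.parent u) := by rcases ha (S.parent u) with h | h <;> linarith
  refine le_add_of_nonneg_of_le hnonneg
    (Finset.single_le_sum (f := fun w => ∫ θ, S.rounded g a w θ ∂thresholdLaw V)
      (fun w _ => integral_nonneg (S.rounded_nonneg a hg w)) (mem_children.2 ⟨hu, rfl⟩))

theorem integral_rounded_le (u : V) : ∫ θ, S.rounded g a u θ ∂thresholdLaw V ≤ ∑ u, a u := by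
  induction hd : S.depth u generalizing u with
  | zero =>
    by_cases hu : u = S.root
    · rw [hu, S.integral_rounded_root hg ha]
    · have := S.depth_parent u hu
      omega
  | succ k ih =>
    have hu : u ≠ S.root := by
      rintro rfl
      rw [S.depth_root] at hd
      omega
    refine (S.integral_rounded_le_parent hg ha hu).trans (ih _ ?_)
    have := S.depth_parent u hu
    omega

theorem covariance_partialSum (u v : V) :
    cov[S.partialSum g a u, S.partialSum g a v; thresholdLaw V] =
      ∑ w ∈ S.children u, ∑ w' ∈ S.children v,
        cov[S.rounded g a w, S.rounded g a w'; thresholdLaw V] := by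
  have hi (u : V) := (S.memLp_sum_rounded hg ha u 2).integrable (by norm_num)
  have heq (u : V) : S.partialSum g a u =
      fun θ => a u + ∑ w ∈ S.children u, S.rounded g a w θ := rfl
  rw [heq u, heq v, covariance_const_add_left (hi u), covariance_const_add_right (hi v)]
  exact covariance_fun_sum_fun_sum' (fun w _ => S.memLp_rounded hg ha w 2)
    fun w _ => S.memLp_rounded hg ha w 2

theorem covariance_rounded_eq {u v : V} (hvu : v ≠ u) (hd : S.depth v = S.depth u) :
    cov[S.rounded g a u, S.rounded g a v; thresholdLaw V] =
      cov[S.partialSum g a u, S.partialSum g a v; thresholdLaw V] := by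
  rw [covariance_eq_sub (S.memLp_rounded hg ha u 2) (S.memLp_rounded hg ha v 2),
    covariance_eq_sub (S.memLp_partialSum hg ha u 2) (S.memLp_partialSum hg ha v 2),
    S.integral_rounded hg ha u, S.integral_rounded hg ha v]
  refine congrArg (· - _) ?_
  calc ∫ θ, S.rounded g a u θ * S.rounded g a v θ ∂thresholdLaw V
      = ∫ θ, S.rounded g a v θ * S.partialSum g a u θ ∂thresholdLaw V := by
        simp_rw [S.integral_rounded_mul hg ha (S.memLp_rounded hg ha v 2)
          fun θ x => S.rounded_update g a θ x v u hd.ge hvu.symm, mul_comm]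
    _ = ∫ θ, S.partialSum g a u θ * S.partialSum g a v θ ∂thresholdLaw V := by
        simp_rw [S.integral_rounded_mul hg ha (S.memLp_partialSum hg ha u 2)
          fun θ x => S.partialSum_update g a θ x hd.le, mul_comm]

theorem covariance_rounded_eq_zero (u : V) : ∀ v, v ≠ u → S.depth v = S.depth u →
    cov[S.rounded g a u, S.rounded g a v; thresholdLaw V] = 0 := by
  induction u using S.induction_children with
  | h u ih =>
    intro v hvu hd
    rw [S.covariance_rounded_eq hg ha hvu hd, S.covariance_partialSum hg ha]
    refine Finset.sum_eq_zero fun w hw => Finset.sum_eq_zero fun w' hw' => ih w hw w' ?_ ?_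
    · rintro rfl
      exact hvu ((mem_children.1 hw').2.symm.trans (mem_children.1 hw).2)
    · rw [depth_of_mem_children hw, depth_of_mem_children hw', hd]

theorem variance_partialSum (u : V) :
    Var[S.partialSum g a u; thresholdLaw V] =
      ∑ w ∈ S.children u, Var[S.rounded g a w; thresholdLaw V] := by
  rw [← covariance_self (S.measurable_partialSum g a u).aemeasurable,
    S.covariance_partialSum hg ha]
  refine Finset.sum_congr rfl fun w hw => ?_
  rw [← covariance_self (S.measurable_rounded g a w).aemeasurable]
  refine Finset.sum_eq_single_of_mem w hw fun w' hw' hne => ?_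
  exact S.covariance_rounded_eq_zero hg ha w w' hne
    (by rw [depth_of_mem_children hw, depth_of_mem_children hw'])

theorem integral_rounded_sq (u : V) :
    ∫ θ, S.rounded g a u θ ^ 2 ∂thresholdLaw V =
      Var[S.rounded g a u; thresholdLaw V] + (∫ θ, S.rounded g a u θ ∂thresholdLaw V) ^ 2 := by
  rw [variance_eq_sub (S.memLp_rounded hg ha u 2)]
  simp

theorem integral_partialSum_sq (u : V) :
    ∫ θ, S.partialSum g a u θ ^ 2 ∂thresholdLaw V =
      ∑ w ∈ S.children u, Var[S.rounded g a w; thresholdLaw V] +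
        (∫ θ, S.rounded g a u θ ∂thresholdLaw V) ^ 2 := by
  rw [← S.variance_partialSum hg ha, variance_eq_sub (S.memLp_partialSum hg ha u 2),
    S.integral_rounded hg ha u]
  simp

theorem exists_gridValue_ge_rounded (u : V) (θ : V → ℝ) :
    ∃ c, gridValue g c ≤ S.partialSum g a u θ ∧
      ∀ w ∈ S.children u, S.rounded g a w θ ≤ gridValue g c := by
  have hau : 0 ≤ a u := by rcases ha u with h | h <;> linarith
  rcases (S.children u).eq_empty_or_nonempty with hempty | hne
  · exact ⟨0, by simpa [gridValue, partialSum, hempty] using hau, by simp [hempty]⟩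
  · obtain ⟨w, hw, hmax⟩ := (S.children u).exists_max_image (fun w => S.rounded g a w θ) hne
    exact ⟨S.code g a θ w, le_add_of_nonneg_of_le hau
      (Finset.single_le_sum (f := fun w => S.rounded g a w θ)
        (fun w _ => S.rounded_nonneg a hg w θ) hw), hmax⟩

theorem integral_rounded_update_sq_le (u : V) (θ : V → ℝ) :
    ∫ x, S.rounded g a u (Function.update θ u x) ^ 2 ∂unitUniform ≤
      g * S.partialSum g a u θ ^ 2 - (g - 1) * ∑ w ∈ S.children u, S.rounded g a w θ ^ 2 := by
  simp_rw [rounded_eq S g a _ u, S.partialSum_update g a _ _ le_rfl, Function.update_self]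
  obtain ⟨c, hc, hcw⟩ := S.exists_gridValue_ge_rounded hg ha u θ
  have hsum : ∑ w ∈ S.children u, S.rounded g a w θ ≤ S.partialSum g a u θ := by
    rw [partialSum]
    rcases ha u with h | h <;> linarith
  have hsq : ∑ w ∈ S.children u, S.rounded g a w θ ^ 2 ≤
      S.partialSum g a u θ * gridValue g c :=
    calc ∑ w ∈ S.children u, S.rounded g a w θ ^ 2
        ≤ ∑ w ∈ S.children u, S.rounded g a w θ * gridValue g c := by
          refine Finset.sum_le_sum fun w hw => ?_
          rw [sq]
          exact mul_le_mul_of_nonneg_left (hcw w hw) (S.rounded_nonneg a hg w θ)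
      _ = (∑ w ∈ S.children u, S.rounded g a w θ) * gridValue g c := by rw [Finset.sum_mul]
      _ ≤ _ := mul_le_mul_of_nonneg_right hsum (gridValue_nonneg hg c)
  refine (integral_gridValue_roundCode_sq_le hg (S.partialSum_eq_zero_or hg ha u θ) hc).trans ?_
  nlinarith

theorem integral_rounded_sq_le (u : V) :
    ∫ θ, S.rounded g a u θ ^ 2 ∂thresholdLaw V ≤
      g * ∫ θ, S.partialSum g a u θ ^ 2 ∂thresholdLaw V -
        (g - 1) * ∑ w ∈ S.children u, ∫ θ, S.rounded g a w θ ^ 2 ∂thresholdLaw V := by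
  have hsq (u : V) : Integrable (fun θ => S.rounded g a u θ ^ 2) (thresholdLaw V) :=
    (S.memLp_rounded hg ha u 2).integrable_sq
  have hpartial : Integrable (fun θ => g * S.partialSum g a u θ ^ 2) (thresholdLaw V) :=
    (S.memLp_partialSum hg ha u 2).integrable_sq.const_mul _
  have hsum : Integrable (fun θ => (g - 1) * ∑ w ∈ S.children u, S.rounded g a w θ ^ 2)
      (thresholdLaw V) := (integrable_finsetSum _ fun w _ => hsq w).const_mul _
  rw [integral_eq_integral_update _ (hsq u) u, ← integral_finsetSum _ fun w _ => hsq w,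
    ← integral_const_mul, ← integral_const_mul, ← integral_sub hpartial hsum]
  exact integral_mono ((measurePreserving_update (fun _ : V => unitUniform)
    u).integrable_comp_of_integrable (hsq u)).integral_prod_left (hpartial.sub hsum)
    (S.integral_rounded_update_sq_le hg ha u)

/- The invariant `Var ≤ (g - 1) * mean ^ 2` passes from the children to `u`: the variance added at
`u` is at most `(g - 1) * (∑ E[X_w]) ^ 2` up to the terms `E[X_w ^ 2]`, which pay for the variance
that the children have accumulated. -/
theorem variance_rounded_le (u : V) :
    Var[S.rounded g a u; thresholdLaw V] ≤
      (g - 1) * (∫ θ, S.rounded g a u θ ∂thresholdLaw V) ^ 2 := by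
  induction u using S.induction_children with
  | h u ih =>
    have hsq := S.integral_rounded_sq_le hg ha u
    simp_rw [S.integral_rounded_sq hg ha] at hsq
    rw [S.integral_partialSum_sq hg ha, Finset.sum_add_distrib] at hsq
    have hchildren := Finset.sum_le_sum ih
    rw [← Finset.mul_sum] at hchildren
    nlinarith

theorem measureReal_rounded_root_le {η : ℝ} (hη : 0 < η) :
    (thresholdLaw V).real {θ | η * ∑ u, a u < |S.rounded g a S.root θ - ∑ u, a u|} ≤
      (g - 1) / η ^ 2 := by
  have hmean := S.integral_rounded_root hg ha
  have hnonneg : 0 ≤ ∑ u, a u :=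
    hmean ▸ integral_nonneg (S.rounded_nonneg a hg S.root)
  rcases hnonneg.eq_or_lt with hzero | hpos
  · have hae := (integral_eq_zero_iff_of_nonneg (S.rounded_nonneg a hg S.root)
      (S.integrable_rounded hg ha S.root)).1 (hmean.trans hzero.symm)
    have hnull : (thresholdLaw V).real
        {θ | η * ∑ u, a u < |S.rounded g a S.root θ - ∑ u, a u|} = 0 := by
      refine (measureReal_eq_zero_iff).2 (measure_mono_null ?_ (ae_iff.1 hae))
      intro θ hθ hθ'
      simp [← hzero, hθ'] at hθ
    exact hnull.trans_le (div_nonneg (by linarith) (sq_nonneg η))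
  · have hchebyshev := meas_ge_le_variance_div_sq (S.memLp_rounded hg ha S.root 2)
      (mul_pos hη hpos)
    have hvar := S.variance_rounded_le hg ha S.root
    rw [hmean] at hchebyshev hvar
    have hsub : {θ | η * ∑ u, a u < |S.rounded g a S.root θ - ∑ u, a u|} ⊆
        {θ | η * ∑ u, a u ≤ |S.rounded g a S.root θ - ∑ u, a u|} :=
      Set.ofPred_subset_ofPred.2 fun θ hθ => hθ.le
    calc (thresholdLaw V).real {θ | η * ∑ u, a u < |S.rounded g a S.root θ - ∑ u, a u|}
        ≤ Var[S.rounded g a S.root; thresholdLaw V] / (η * ∑ u, a u) ^ 2 :=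
          ENNReal.toReal_le_of_le_ofReal (div_nonneg (variance_nonneg _ _) (sq_nonneg _))
            ((measure_mono hsub).trans hchebyshev)
      _ ≤ (g - 1) * (∑ u, a u) ^ 2 / (η * ∑ u, a u) ^ 2 := by gcongr
      _ = (g - 1) / η ^ 2 := by
          rw [mul_pow]
          field_simp

theorem measureReal_exists_le_rounded_le {R : ℝ} (hR : 0 < R) :
    (thresholdLaw V).real {θ | ∃ u, R ≤ S.rounded g a u θ} ≤
      Fintype.card V * (∑ u, a u) / R := by
  have hmarkov (u : V) :
      (thresholdLaw V).real {θ | R ≤ S.rounded g a u θ} ≤ (∑ u, a u) / R := by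
    rw [le_div_iff₀ hR, mul_comm]
    exact (mul_meas_ge_le_integral_of_nonneg (ae_of_all _ (S.rounded_nonneg a hg u))
      (S.integrable_rounded hg ha u) R).trans (S.integral_rounded_le hg ha u)
  rw [Set.ofPred_exists]
  refine (measureReal_iUnion_fintype_le _).trans ((Finset.sum_le_sum fun u _ => hmarkov u).trans ?_)
  rw [Finset.sum_const, nsmul_eq_mul, Finset.card_univ, mul_div_assoc]

end Moments

end RootedTree

/-! ### Truncated stable variables -/

section Sketch

theorem ae_mem_Ioc_unitUniform : ∀ᵐ x ∂unitUniform, x ∈ Set.Ioc (0 : ℝ) 1 :=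
  ae_restrict_mem measurableSet_Ioc

theorem integral_unitUniform (h : ℝ → ℝ) : ∫ x, h x ∂unitUniform = ∫ x in (0 : ℝ)..1, h x := by
  rw [unitUniform, intervalIntegral.integral_of_le zero_le_one]

theorem integral_exp_neg_mul_abs_log {s : ℝ} (hs : 0 ≤ s) :
    ∫ u, Real.exp (-(s * |Real.log u|)) ∂unitUniform = 1 / (s + 1) := by
  have hpow : ∫ u, Real.exp (-(s * |Real.log u|)) ∂unitUniform = ∫ u, u ^ s ∂unitUniform := by
    refine integral_congr_ae ?_
    filter_upwards [ae_mem_Ioc_unitUniform] with u hu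
    rw [abs_of_nonpos (Real.log_nonpos hu.1.le hu.2), Real.rpow_def_of_pos hu.1]
    ring_nf
  rw [hpow, integral_unitUniform, integral_rpow (Or.inl (by linarith))]
  simp [Real.zero_rpow (by linarith : s + 1 ≠ 0)]

theorem integrable_abs_log : Integrable (fun u => |Real.log u|) unitUniform :=
  ((intervalIntegrable_iff_integrableOn_Ioc_of_le zero_le_one).1
    intervalIntegral.intervalIntegrable_log').abs

theorem integral_abs_log : ∫ u, |Real.log u| ∂unitUniform = 1 := by
  have hneg : ∫ u, |Real.log u| ∂unitUniform = ∫ u, -Real.log u ∂unitUniform := by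
    refine integral_congr_ae ?_
    filter_upwards [ae_mem_Ioc_unitUniform] with u hu
    rw [abs_of_nonpos (Real.log_nonpos hu.1.le hu.2)]
  rw [hneg, integral_neg, integral_unitUniform, integral_log]
  simp

/-- An exponential jump `|log u| / y` whose rate `y = r * x` is uniform on `[0, r]`; jumps with a
rate outside `[β, α]` are discarded. The sum of `r` such jumps approximates a compound Poisson
variable whose jumps have Lévy density `1 / z ^ 2`, up to the truncation. -/
def jump (r β α : ℝ) (p : ℝ × ℝ) : ℝ :=
  if r * p.1 ∈ Set.Icc β α then |Real.log p.2| / (r * p.1) else 0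

variable {r β α : ℝ}

theorem measurable_jump : Measurable (jump r β α) := by
  refine Measurable.ite (measurable_fst.const_mul r measurableSet_Icc) ?_ measurable_const
  exact (continuous_abs.measurable.comp (Real.measurable_log.comp measurable_snd)).div
    (measurable_fst.const_mul r)

theorem jump_nonneg (hβ : 0 < β) (p : ℝ × ℝ) : 0 ≤ jump r β α p := by
  unfold jump
  split_ifs with hp
  · exact div_nonneg (abs_nonneg _) (hβ.le.trans hp.1)
  · exact le_rfl

theorem integral_indicator_mul_left_unitUniform (hβ : 0 < β) (hβα : β ≤ α) (hαr : α ≤ r)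
    (f : ℝ → ℝ) :
    ∫ x, (Set.Icc β α).indicator f (r * x) ∂unitUniform = (∫ y in β..α, f y) / r := by
  have hr : 0 < r := hβ.trans_le (hβα.trans hαr)
  have hsub : Set.Icc β α ⊆ Set.Ioc 0 r := fun y hy => ⟨hβ.trans_le hy.1, hy.2.trans hαr⟩
  rw [integral_unitUniform,
    intervalIntegral.integral_comp_mul_left ((Set.Icc β α).indicator f) hr.ne', mul_zero, mul_one,
    intervalIntegral.integral_of_le hr.le, intervalIntegral.integral_of_le hβα,
    setIntegral_indicator measurableSet_Icc, Set.inter_eq_right.2 hsub,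
    integral_Icc_eq_integral_Ioc, smul_eq_mul, div_eq_inv_mul]

theorem integrable_jump (hβ : 0 < β) : Integrable (jump r β α) (unitUniform.prod unitUniform) := by
  have hdom : Integrable (fun p : ℝ × ℝ => |Real.log p.2| / β) (unitUniform.prod unitUniform) :=
    (integrable_abs_log.div_const β).comp_snd unitUniform
  refine hdom.mono' measurable_jump.aestronglyMeasurable (ae_of_all _ fun p => ?_)
  rw [Real.norm_of_nonneg (jump_nonneg hβ p), jump]
  split_ifs with hp
  · have := hp.1
    gcongr
  · positivity

theorem integral_jump (hβ : 0 < β) (hβα : β ≤ α) (hαr : α ≤ r) :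
    ∫ p, jump r β α p ∂unitUniform.prod unitUniform = Real.log (α / β) / r := by
  have hsection (x : ℝ) : ∫ u, jump r β α (x, u) ∂unitUniform =
      (Set.Icc β α).indicator (fun y => y⁻¹) (r * x) := by
    by_cases hx : r * x ∈ Set.Icc β α
    · simp only [jump, hx, if_true, Set.indicator_of_mem]
      rw [integral_div, integral_abs_log, one_div]
    · simp [jump, hx]
  rw [integral_prod _ (integrable_jump hβ)]
  simp_rw [hsection]
  rw [integral_indicator_mul_left_unitUniform hβ hβα hαr,
    integral_inv_of_pos hβ (hβ.trans_le hβα)]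

theorem integral_div_add_const {t : ℝ} (hβ : 0 < β) (hβα : β ≤ α) (ht : 0 ≤ t) :
    ∫ y in β..α, t / (y + t) = t * (Real.log (α + t) - Real.log (β + t)) := by
  simp_rw [div_eq_mul_inv]
  rw [intervalIntegral.integral_const_mul,
    intervalIntegral.integral_comp_add_right (fun y => y⁻¹),
    integral_inv_of_pos (by linarith) (by linarith), Real.log_div (by linarith) (by linarith)]

theorem integrable_exp_neg_mul_of_nonneg {Ω : Type*} [MeasurableSpace Ω] {μ : Measure Ω}
    [IsFiniteMeasure μ] {Y : Ω → ℝ} (hY : AEStronglyMeasurable Y μ) (hY₀ : ∀ ω, 0 ≤ Y ω) {t : ℝ}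
    (ht : 0 ≤ t) : Integrable (fun ω => Real.exp (-t * Y ω)) μ := by
  refine Integrable.of_bound (C := 1)
    (Real.continuous_exp.comp_aestronglyMeasurable (hY.const_mul (-t))) (ae_of_all _ fun ω => ?_)
  rw [Real.norm_of_nonneg (Real.exp_pos _).le, Real.exp_le_one_iff, neg_mul, neg_nonpos]
  exact mul_nonneg ht (hY₀ ω)

theorem mgf_jump {t : ℝ} (hβ : 0 < β) (hβα : β ≤ α) (hαr : α ≤ r) (ht : 0 ≤ t) :
    mgf (jump r β α) (unitUniform.prod unitUniform) (-t) =
      1 - t * (Real.log (α + t) - Real.log (β + t)) / r := by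
  have hint : Integrable (fun p => Real.exp (-t * jump r β α p)) (unitUniform.prod unitUniform) :=
    integrable_exp_neg_mul_of_nonneg measurable_jump.aestronglyMeasurable (jump_nonneg hβ) ht
  have hsection (x : ℝ) : ∫ u, Real.exp (-t * jump r β α (x, u)) ∂unitUniform =
      1 - (Set.Icc β α).indicator (fun y => t / (y + t)) (r * x) := by
    by_cases hx : r * x ∈ Set.Icc β α
    · have hpos : 0 < r * x := hβ.trans_le hx.1
      have hexp (u : ℝ) : -t * (|Real.log u| / (r * x)) = -(t / (r * x) * |Real.log u|) := by ring
      simp only [jump, hx, if_true, Set.indicator_of_mem, hexp]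
      rw [integral_exp_neg_mul_abs_log (div_nonneg ht hpos.le), div_add_one hpos.ne', one_div_div,
        one_sub_div (by positivity), add_sub_cancel_right, add_comm t]
    · simp [jump, hx]
  have hindicator : Integrable
      (fun x => (Set.Icc β α).indicator (fun y => t / (y + t)) (r * x)) unitUniform := by
    refine Integrable.of_bound (C := 1) (Measurable.aestronglyMeasurable ?_)
      (ae_of_all _ fun x => ?_)
    · exact ((measurable_const.div (measurable_id.add_const t)).indicator measurableSet_Icc).comp
        (measurable_const_mul r)
    · by_cases hx : r * x ∈ Set.Icc β α
      · have hpos : 0 < r * x + t := by linarith [hx.1]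
        rw [Set.indicator_of_mem hx, Real.norm_of_nonneg (by positivity), div_le_one hpos]
        linarith [hx.1]
      · simp [hx]
  rw [mgf, integral_prod _ hint]
  simp_rw [hsection]
  rw [integral_sub (integrable_const _) hindicator,
    integral_indicator_mul_left_unitUniform hβ hβα hαr,
    integral_div_add_const hβ hβα ht]
  simp

/-- The sum of `r` jumps, as a function of the randomness of the individual jumps. -/
def jumpSum (r : ℕ) (β α : ℝ) (ω : Fin r → ℝ × ℝ) : ℝ := ∑ l, jump r β α (ω l)

/-- The law of the randomness of `r` independent jumps. -/
def jumpLaw (r : ℕ) : Measure (Fin r → ℝ × ℝ) :=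
  Measure.pi fun _ => unitUniform.prod unitUniform

instance (r : ℕ) : IsProbabilityMeasure (jumpLaw r) := by unfold jumpLaw; infer_instance

theorem measurable_jumpSum (r : ℕ) : Measurable (jumpSum r β α) :=
  Finset.measurable_fun_sum _ fun l _ => measurable_jump.comp (measurable_pi_apply l)

theorem integrable_jump_apply {r : ℕ} (hβ : 0 < β) (l : Fin r) :
    Integrable (fun ω => jump r β α (ω l)) (jumpLaw r) :=
  integrable_comp_eval (μ := fun _ : Fin r => unitUniform.prod unitUniform) (integrable_jump hβ)

theorem integral_jumpSum {r : ℕ} (hβ : 0 < β) (hβα : β ≤ α) (hαr : α ≤ r) :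
    ∫ ω, jumpSum r β α ω ∂jumpLaw r = Real.log (α / β) := by
  have hjump (l : Fin r) : ∫ ω, jump r β α (ω l) ∂jumpLaw r = Real.log (α / β) / r := by
    rw [jumpLaw, integral_comp_eval (μ := fun _ : Fin r => unitUniform.prod unitUniform)
      measurable_jump.aestronglyMeasurable, integral_jump hβ hβα hαr]
  have hr : (r : ℝ) ≠ 0 := (hβ.trans_le (hβα.trans hαr)).ne'
  simp only [jumpSum]
  rw [integral_finsetSum _ fun l _ => integrable_jump_apply hβ l]
  simp only [hjump, Finset.sum_const, Finset.card_univ, Fintype.card_fin, nsmul_eq_mul]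
  rw [mul_div_cancel₀ _ hr]

theorem cgf_jumpSum {r : ℕ} {t : ℝ} (hβ : 0 < β) (hβα : β ≤ α) (hαr : α ≤ r) (ht : 0 ≤ t) :
    cgf (jumpSum r β α) (jumpLaw r) (-t) =
      r * Real.log (1 - t * (Real.log (α + t) - Real.log (β + t)) / r) := by
  have hprod (ω : Fin r → ℝ × ℝ) : Real.exp (-t * jumpSum r β α ω) =
      ∏ l, Real.exp (-t * jump r β α (ω l)) := by
    rw [← Real.exp_sum, jumpSum, Finset.mul_sum]
  rw [cgf, mgf]
  simp_rw [hprod]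
  rw [jumpLaw, integral_fintype_prod_eq_pow (ι := Fin r) fun p => Real.exp (-t * jump r β α p),
    Fintype.card_fin, Real.log_pow, ← mgf, mgf_jump hβ hβα hαr ht]

theorem abs_mul_log_one_sub_add_le {ψ : ℝ} (hr : 0 < r) (hψ : 0 ≤ ψ) (hψr : 2 * ψ ≤ r) :
    |r * Real.log (1 - ψ / r) + ψ| ≤ 2 * ψ ^ 2 / r := by
  obtain ⟨y, rfl⟩ : ∃ y, ψ = r * y := ⟨ψ / r, by field_simp⟩
  have hy₀ : 0 ≤ y := nonneg_of_mul_nonneg_right hψ hr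
  have hy₁ : y ≤ 1 / 2 := by nlinarith
  have hpos : 0 < 1 - y := by linarith
  have hupper := Real.log_le_sub_one_of_pos hpos
  have hlower := Real.one_sub_inv_le_log_of_pos hpos
  have hinv : (1 - y)⁻¹ ≤ 1 + y + 2 * y ^ 2 := by
    rw [inv_le_iff_one_le_mul₀ hpos]
    nlinarith [mul_nonneg hy₀ (mul_nonneg hy₀ (by linarith : (0 : ℝ) ≤ 1 - 2 * y))]
  have hscale : 2 * (r * y) ^ 2 / r = r * (2 * y ^ 2) := by field_simp
  rw [mul_div_cancel_left₀ y hr.ne', ← mul_add, abs_mul, abs_of_pos hr, hscale]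
  refine mul_le_mul_of_nonneg_left (abs_le.2 ⟨?_, ?_⟩) hr.le <;> linarith [sq_nonneg y]

theorem log_add_sub_log_le {x y : ℝ} (hx : 0 < x) (hy : 0 ≤ y) :
    Real.log (x + y) - Real.log x ≤ y / x := by
  rw [← Real.log_div (by positivity) hx.ne', add_div, div_self hx.ne']
  linarith [Real.log_le_sub_one_of_pos (by positivity : 0 < 1 + y / x)]

theorem abs_log_add_sub_log_add_le {t τ : ℝ} (hβ : 0 ≤ β) (hα : 0 < α) (ht : 0 < t)
    (htα : t ≤ τ * α) (hβt : β ≤ τ * t) :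
    |(Real.log (α + t) - Real.log (β + t)) - (Real.log α - Real.log t)| ≤ τ := by
  have hα_upper := (log_add_sub_log_le hα ht.le).trans ((div_le_iff₀ hα).2 htα)
  have ht_upper := (log_add_sub_log_le ht hβ).trans ((div_le_iff₀ ht).2 hβt)
  have hα_lower : Real.log α ≤ Real.log (α + t) := Real.log_le_log hα (by linarith)
  have ht_lower : Real.log t ≤ Real.log (t + β) := Real.log_le_log ht (by linarith)
  rw [add_comm β, abs_le]
  constructor <;> linarith

theorem log_add_sub_log_add_mem_Icc {t : ℝ} (hβ : 0 < β) (hβα : β ≤ α) (ht : 0 ≤ t) :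
    Real.log (α + t) - Real.log (β + t) ∈ Set.Icc 0 (Real.log (α / β)) := by
  have hα : 0 < α := hβ.trans_le hβα
  refine ⟨sub_nonneg.2 (Real.log_le_log (by positivity) (by linarith)), ?_⟩
  rw [← Real.log_div (by positivity) (by positivity)]
  refine Real.log_le_log (by positivity) ?_
  rw [div_le_div_iff₀ (by positivity) hβ]
  nlinarith

/-- A nonnegative variable `Z` whose cumulant generating function at `-t` is, on the range
`1 / N ≤ t ≤ 2`, close to `t * log t` up to a linear term, as for a one-sided `1`-stable variable.
Unlike the latter, `Z` has a finite mean. -/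
structure IsEntropySketch {Ω : Type*} [MeasurableSpace Ω] (Z : Ω → ℝ) (μ : Measure Ω)
    (N τ : ℝ) : Prop where
  measurable : Measurable Z
  nonneg : ∀ ω, 0 ≤ Z ω
  integrable : Integrable Z μ
  integral_eq : ∫ ω, Z ω ∂μ = Real.log (2 * N / τ ^ 2)
  abs_cgf_sub_le : ∀ t, 1 / N ≤ t → t ≤ 2 →
    |cgf Z μ (-t) - (t * Real.log t - t * Real.log (2 / τ))| ≤ 2 * τ * t

theorem abs_cgf_jumpSum_sub_le {r : ℕ} {t τ : ℝ} (hβ : 0 < β) (hβα : β ≤ α) (hαr : α ≤ r)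
    (ht₀ : 0 < t) (ht₂ : t ≤ 2) (htα : t ≤ τ * α) (hβt : β ≤ τ * t)
    (hr : 4 * Real.log (α / β) ≤ r) (hrτ : 4 * Real.log (α / β) ^ 2 ≤ τ * r) :
    |cgf (jumpSum r β α) (jumpLaw r) (-t) - (t * Real.log t - t * Real.log α)| ≤ 2 * τ * t := by
  set δ := Real.log (α + t) - Real.log (β + t)
  have hα : 0 < α := hβ.trans_le hβα
  have hr₀ : (0 : ℝ) < r := hα.trans_le hαr
  obtain ⟨hδ₀, hδ⟩ : δ ∈ Set.Icc 0 (Real.log (α / β)) :=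
    log_add_sub_log_add_mem_Icc hβ hβα ht₀.le
  have hδt := abs_log_add_sub_log_add_le hβ.le hα ht₀ htα hβt
  have hδsq : δ ^ 2 ≤ Real.log (α / β) ^ 2 := pow_le_pow_left₀ hδ₀ hδ 2
  have hlog : |r * Real.log (1 - t * δ / r) + t * δ| ≤ τ * t := by
    refine (abs_mul_log_one_sub_add_le hr₀ (mul_nonneg ht₀.le hδ₀) (by nlinarith)).trans ?_
    rw [div_le_iff₀ hr₀]
    nlinarith [mul_le_mul_of_nonneg_left ht₂ (mul_nonneg ht₀.le (sq_nonneg δ))]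
  calc |cgf (jumpSum r β α) (jumpLaw r) (-t) - (t * Real.log t - t * Real.log α)|
      = |(r * Real.log (1 - t * δ / r) + t * δ) - t * (δ - (Real.log α - Real.log t))| := by
        rw [cgf_jumpSum hβ hβα hαr ht₀.le]
        congr 1
        ring
    _ ≤ τ * t + t * τ := by
        refine (abs_sub _ _).trans (add_le_add hlog ?_)
        rw [abs_mul, abs_of_pos ht₀]
        exact mul_le_mul_of_nonneg_left hδt ht₀.le
    _ = 2 * τ * t := by ring

theorem exists_isEntropySketch {N τ : ℝ} (hN : 1 ≤ N) (hτ₀ : 0 < τ) (hτ₁ : τ ≤ 1) :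
    ∃ (Ω : Type) (_ : MeasurableSpace Ω) (μ : Measure Ω) (_ : IsProbabilityMeasure μ) (Z : Ω → ℝ),
      IsEntropySketch Z μ N τ := by
  have hN₀ : 0 < N := by linarith
  have hβ : 0 < τ / N := by positivity
  have hβα : τ / N ≤ 2 / τ := by
    rw [div_le_div_iff₀ hN₀ hτ₀]
    nlinarith
  set K := Real.log (2 / τ / (τ / N))
  obtain ⟨r, hr⟩ := exists_nat_ge (max (2 / τ) (max (4 * K) (4 * K ^ 2 / τ)))
  simp only [max_le_iff] at hr
  obtain ⟨hαr, hKr, hKτ⟩ := hr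
  refine ⟨Fin r → ℝ × ℝ, inferInstance, jumpLaw r, inferInstance, jumpSum r (τ / N) (2 / τ), ?_⟩
  exact
    { measurable := measurable_jumpSum r
      nonneg := fun ω => Finset.sum_nonneg fun l _ => jump_nonneg hβ (ω l)
      integrable := integrable_finsetSum _ fun l _ => integrable_jump_apply hβ l
      integral_eq := by
        rw [integral_jumpSum hβ hβα hαr]
        congr 1
        field_simp
      abs_cgf_sub_le := fun t ht₁ ht₂ => by
        refine abs_cgf_jumpSum_sub_le hβ hβα hαr (lt_of_lt_of_le (by positivity) ht₁) ht₂ ?_ ?_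
          hKr ((div_le_iff₀' hτ₀).1 hKτ)
        · rwa [mul_div_cancel₀ _ hτ₀.ne']
        · rw [div_eq_mul_one_div]
          exact mul_le_mul_of_nonneg_left ht₁ hτ₀.le }

end Sketch

/-! ### Concentration of the sketches -/

section Statistics

variable {Ω ι : Type*} [MeasurableSpace Ω] [Fintype ι] {μ : Measure Ω} [IsProbabilityMeasure μ]

theorem measureReal_average_sub_integral_ge_le {f : Ω → ℝ} (hf : MemLp f 2 μ) {k : ℕ}
    (hk : k ≠ 0) {δ : ℝ} (hδ : 0 < δ) :
    (Measure.pi fun _ : Fin k => μ).real {ω | δ ≤ |(∑ q, f (ω q)) / k - ∫ x, f x ∂μ|} ≤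
      Var[f; μ] / (k * δ ^ 2) := by
  have hk₀ : (k : ℝ) ≠ 0 := Nat.cast_ne_zero.2 hk
  set ν := Measure.pi fun _ : Fin k => μ
  have hf_eval (q : Fin k) : MemLp (fun ω : Fin k → Ω => f (ω q)) 2 ν :=
    hf.comp_measurePreserving (measurePreserving_eval _ q)
  have hsum : MemLp (fun ω => ∑ q : Fin k, f (ω q)) 2 ν := memLp_finsetSum _ fun q _ => hf_eval q
  have haverage : MemLp (fun ω : Fin k → Ω => (∑ q, f (ω q)) / k) 2 ν := by
    simpa only [div_eq_inv_mul] using hsum.const_mul (k : ℝ)⁻¹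
  have hmean : ∫ ω, (∑ q, f (ω q)) / k ∂ν = ∫ x, f x ∂μ := by
    rw [integral_div, integral_finsetSum _ fun q _ => (hf_eval q).integrable (by norm_num)]
    simp only [ν, integral_comp_eval (μ := fun _ : Fin k => μ) hf.aestronglyMeasurable,
      Finset.sum_const, Finset.card_univ, Fintype.card_fin, nsmul_eq_mul]
    exact mul_div_cancel_left₀ _ hk₀
  have hvar_sum : Var[fun ω => ∑ q, f (ω q); ν] = k * Var[f; μ] := by
    have hpi := variance_sum_pi (X := fun _ : Fin k => f) fun _ => hf
    simp only [Finset.sum_const, Finset.card_univ, Fintype.card_fin, nsmul_eq_mul] at hpi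
    rw [← hpi]
    congr 1
    ext ω
    simp only [Finset.sum_apply]
  have hvar : Var[fun ω => (∑ q, f (ω q)) / k; ν] = Var[f; μ] / k := by
    simp_rw [div_eq_inv_mul]
    rw [variance_const_mul, hvar_sum]
    field_simp
  have hchebyshev := meas_ge_le_variance_div_sq haverage hδ
  rw [hmean, hvar, div_div] at hchebyshev
  exact ENNReal.toReal_le_of_le_ofReal
    (div_nonneg (variance_nonneg _ _) (by positivity)) hchebyshev

theorem measureReal_exists_ge_le {f : Ω → ℝ} (hf₀ : ∀ x, 0 ≤ f x) (hf : Integrable f μ) (k : ℕ)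
    {T : ℝ} (hT : 0 < T) :
    (Measure.pi fun _ : Fin k => μ).real {ω | ∃ q, T ≤ f (ω q)} ≤ k * (∫ x, f x ∂μ) / T := by
  have hmarkov (q : Fin k) :
      (Measure.pi fun _ : Fin k => μ).real {ω | T ≤ f (ω q)} ≤ (∫ x, f x ∂μ) / T := by
    rw [le_div_iff₀ hT, mul_comm,
      ← integral_comp_eval (μ := fun _ : Fin k => μ) (i := q) hf.aestronglyMeasurable]
    exact mul_meas_ge_le_integral_of_nonneg (f := fun ω : Fin k → Ω => f (ω q))
      (ae_of_all _ fun ω => hf₀ (ω q))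
      (integrable_comp_eval (μ := fun _ : Fin k => μ) (i := q) hf) T
  rw [Set.ofPred_exists]
  refine (measureReal_iUnion_fintype_le _).trans ((Finset.sum_le_sum fun q _ => hmarkov q).trans ?_)
  rw [Finset.sum_const, nsmul_eq_mul, Finset.card_univ, Fintype.card_fin, mul_div_assoc]

/-- A probability vector whose nonzero entries are at least `1 / N`, such as the normalization of
a nonzero vector of natural numbers with sum at most `N`. -/
structure IsWeightVector (N : ℝ) (p : ι → ℝ) : Prop where
  eq_zero_or : ∀ j, p j = 0 ∨ 1 / N ≤ p j
  sum_eq_one : ∑ j, p j = 1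

theorem IsWeightVector.nonneg {N : ℝ} {p : ι → ℝ} (hp : IsWeightVector N p) (hN : 0 ≤ N) (j : ι) :
    0 ≤ p j := by
  rcases hp.eq_zero_or j with hj | hj
  · exact hj.ge
  · exact (one_div_nonneg.2 hN).trans hj

theorem IsWeightVector.le_one {N : ℝ} {p : ι → ℝ} (hp : IsWeightVector N p) (hN : 0 ≤ N) (j : ι) :
    p j ≤ 1 :=
  hp.sum_eq_one ▸ Finset.single_le_sum (fun i _ => hp.nonneg hN i) (Finset.mem_univ j)

/-- The exponential of a linear sketch of the vector `p`, where every coordinate carries its own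
copy of `Z`. -/
def expSketch (Z : Ω → ℝ) (p : ι → ℝ) (ω : ι → Ω) : ℝ := Real.exp (-∑ j, p j * Z (ω j))

/-- The expectation of `expSketch Z p`. For a weight vector `p` and an entropy sketch `Z`, its
logarithm is minus the entropy of `p`, up to an additive constant and a small error. -/
def sketchMean (μ : Measure Ω) (Z : Ω → ℝ) (p : ι → ℝ) : ℝ :=
  ∫ ω, expSketch Z p ω ∂(Measure.pi fun _ : ι => μ)

theorem sketchMean_eq_prod (Z : Ω → ℝ) (p : ι → ℝ) :
    sketchMean μ Z p = ∏ j, mgf Z μ (-p j) := by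
  simp only [mgf, sketchMean, expSketch]
  rw [← integral_fintype_prod_eq_prod (𝕜 := ℝ) fun j ω => Real.exp (-p j * Z ω)]
  simp_rw [← Real.exp_sum, neg_mul, Finset.sum_neg_distrib]

theorem measurable_expSketch {Z : Ω → ℝ} (hZ : Measurable Z) (p : ι → ℝ) :
    Measurable (expSketch Z p) :=
  Real.measurable_exp.comp (Finset.measurable_fun_sum _ fun j _ =>
    (hZ.comp (measurable_pi_apply j)).const_mul (p j)).neg

theorem expSketch_sq {Ω ι : Type*} [Fintype ι] (Z : Ω → ℝ) (p : ι → ℝ) (ω : ι → Ω) :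
    expSketch Z p ω ^ 2 = expSketch Z (2 • p) ω := by
  rw [expSketch, expSketch, ← Real.exp_nat_mul, Nat.cast_two, mul_neg, Finset.mul_sum]
  simp only [Pi.smul_apply, nsmul_eq_mul, Nat.cast_ofNat, mul_assoc]

namespace IsEntropySketch

variable {Z : Ω → ℝ} {N τ : ℝ} (hZ : IsEntropySketch Z μ N τ)

include hZ

theorem mgf_pos {t : ℝ} (ht : 0 ≤ t) : 0 < mgf Z μ (-t) :=
  ProbabilityTheory.mgf_pos
    (integrable_exp_neg_mul_of_nonneg hZ.measurable.aestronglyMeasurable hZ.nonneg ht)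

theorem sketchMean_pos {p : ι → ℝ} (hp : ∀ j, 0 ≤ p j) : 0 < sketchMean μ Z p := by
  rw [sketchMean_eq_prod]
  exact Finset.prod_pos fun j _ => hZ.mgf_pos (hp j)

theorem abs_log_sketchMean_sub_sum_le (hN : 0 ≤ N) {p : ι → ℝ}
    (hp : ∀ j, p j = 0 ∨ 1 / N ≤ p j ∧ p j ≤ 2) :
    |Real.log (sketchMean μ Z p) - ∑ j, (p j * Real.log (p j) - p j * Real.log (2 / τ))| ≤
      2 * τ * ∑ j, p j := by
  have hp₀ (j : ι) : 0 ≤ p j := by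
    rcases hp j with hj | hj
    · exact hj.ge
    · exact (one_div_nonneg.2 hN).trans hj.1
  have hterm (j : ι) : |Real.log (mgf Z μ (-p j)) -
      (p j * Real.log (p j) - p j * Real.log (2 / τ))| ≤ 2 * τ * p j := by
    rcases hp j with hj | hj
    · simp [hj]
    · exact hZ.abs_cgf_sub_le _ hj.1 hj.2
  rw [sketchMean_eq_prod, Real.log_prod fun j _ => (hZ.mgf_pos (hp₀ j)).ne',
    ← Finset.sum_sub_distrib, Finset.mul_sum]
  exact (Finset.abs_sum_le_sum_abs _ _).trans (Finset.sum_le_sum fun j _ => hterm j)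

theorem abs_log_sketchMean_sub_le (hN : 0 ≤ N) {p : ι → ℝ} (hp : IsWeightVector N p) :
    |Real.log (sketchMean μ Z p) - (∑ j, p j * Real.log (p j) - Real.log (2 / τ))| ≤ 2 * τ := by
  have hmean := hZ.abs_log_sketchMean_sub_sum_le hN fun j =>
    (hp.eq_zero_or j).imp_right fun hj => ⟨hj, (hp.le_one hN j).trans one_le_two⟩
  rwa [Finset.sum_sub_distrib, ← Finset.sum_mul, hp.sum_eq_one, one_mul, mul_one] at hmean

theorem abs_log_sketchMean_two_smul_sub_le (hN : 0 ≤ N) {p : ι → ℝ} (hp : IsWeightVector N p) :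
    |Real.log (sketchMean μ Z (2 • p)) -
      (2 * Real.log 2 + 2 * (∑ j, p j * Real.log (p j) - Real.log (2 / τ)))| ≤ 4 * τ := by
  have hmean := hZ.abs_log_sketchMean_sub_sum_le hN (p := 2 • p) fun j => by
    rw [Pi.smul_apply, nsmul_eq_mul, Nat.cast_two]
    refine (hp.eq_zero_or j).imp (fun hj => by simp [hj]) fun hj => ?_
    constructor <;> linarith [hp.le_one hN j, hp.nonneg hN j]
  have hsum_two : ∑ j, (2 • p) j = 2 := by
    simp only [Pi.smul_apply]
    rw [← Finset.smul_sum, hp.sum_eq_one, nsmul_eq_mul, Nat.cast_two, mul_one]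
  have hterm (j : ι) : (2 • p) j * Real.log ((2 • p) j) - (2 • p) j * Real.log (2 / τ) =
      2 * Real.log 2 * p j + 2 * (p j * Real.log (p j)) - 2 * Real.log (2 / τ) * p j := by
    rw [Pi.smul_apply, nsmul_eq_mul, Nat.cast_two]
    rcases eq_or_ne (p j) 0 with hj | hj
    · simp [hj]
    · rw [Real.log_mul two_ne_zero hj]
      ring
  have hsum : ∑ j, ((2 • p) j * Real.log ((2 • p) j) - (2 • p) j * Real.log (2 / τ)) =
      2 * Real.log 2 + 2 * (∑ j, p j * Real.log (p j) - Real.log (2 / τ)) := by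
    rw [Finset.sum_congr rfl fun j _ => hterm j, Finset.sum_sub_distrib, Finset.sum_add_distrib,
      ← Finset.mul_sum, ← Finset.mul_sum, ← Finset.mul_sum, hp.sum_eq_one]
    ring
  rw [hsum, hsum_two] at hmean
  exact hmean.trans_eq (by ring)

theorem sketchMean_two_smul_le (hN : 0 ≤ N) (hτ : τ ≤ 1 / 40) {p : ι → ℝ}
    (hp : IsWeightVector N p) : sketchMean μ Z (2 • p) ≤ 5 * sketchMean μ Z p ^ 2 := by
  have hpos := hZ.sketchMean_pos (hp.nonneg hN)
  have hpos_two : 0 < sketchMean μ Z (2 • p) :=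
    hZ.sketchMean_pos fun j => nsmul_nonneg (hp.nonneg hN j) 2
  have hlog : 1 / 5 ≤ Real.log 5 - 2 * Real.log 2 := by
    have hquot : Real.log 5 - 2 * Real.log 2 = Real.log (5 / 4) := by
      rw [Real.log_div (by norm_num) (by norm_num), show (4 : ℝ) = 2 ^ 2 by norm_num, Real.log_pow,
        Nat.cast_two]
    have hlower := Real.one_sub_inv_le_log_of_pos (show (0 : ℝ) < 5 / 4 by norm_num)
    rw [hquot]
    norm_num at hlower ⊢
    linarith
  have hlower := (abs_le.1 (hZ.abs_log_sketchMean_sub_le hN hp)).1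
  have hupper := (abs_le.1 (hZ.abs_log_sketchMean_two_smul_sub_le hN hp)).2
  rw [← Real.log_le_log_iff hpos_two (by positivity), Real.log_mul (by norm_num) (by positivity),
    Real.log_pow, Nat.cast_two]
  linarith

theorem memLp_expSketch {p : ι → ℝ} (hp : ∀ j, 0 ≤ p j) :
    MemLp (expSketch Z p) 2 (Measure.pi fun _ : ι => μ) := by
  refine MemLp.of_bound (measurable_expSketch hZ.measurable p).aestronglyMeasurable 1
    (ae_of_all _ fun ω => ?_)
  rw [expSketch, Real.norm_of_nonneg (Real.exp_pos _).le, Real.exp_le_one_iff, neg_nonpos]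
  exact Finset.sum_nonneg fun j _ => mul_nonneg (hp j) (hZ.nonneg _)

theorem variance_expSketch_le (hN : 0 ≤ N) (hτ : τ ≤ 1 / 40) {p : ι → ℝ}
    (hp : IsWeightVector N p) :
    Var[expSketch Z p; Measure.pi fun _ : ι => μ] ≤ 5 * sketchMean μ Z p ^ 2 := by
  refine (variance_le_expectation_sq
    (measurable_expSketch hZ.measurable p).aestronglyMeasurable).trans ?_
  simp only [Pi.pow_apply, expSketch_sq]
  exact hZ.sketchMean_two_smul_le hN hτ hp

theorem measureReal_average_expSketch_le (hN : 0 ≤ N) (hτ₀ : 0 < τ) (hτ : τ ≤ 1 / 40) {p : ι → ℝ}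
    (hp : IsWeightVector N p) {k : ℕ} (hk : k ≠ 0) :
    (Measure.pi fun _ : Fin k => Measure.pi fun _ : ι => μ).real
      {ω | τ * sketchMean μ Z p ≤ |(∑ q, expSketch Z p (ω q)) / k - sketchMean μ Z p|} ≤
        5 / (k * τ ^ 2) := by
  have hpos := hZ.sketchMean_pos (hp.nonneg hN)
  refine (measureReal_average_sub_integral_ge_le (hZ.memLp_expSketch (hp.nonneg hN)) hk
    (mul_pos hτ₀ hpos)).trans ?_
  calc Var[expSketch Z p; Measure.pi fun _ : ι => μ] / (k * (τ * sketchMean μ Z p) ^ 2)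
      ≤ 5 * sketchMean μ Z p ^ 2 / (k * (τ * sketchMean μ Z p) ^ 2) := by
        gcongr
        exact hZ.variance_expSketch_le hN hτ hp
    _ = 5 / (k * τ ^ 2) := by
        rw [mul_pow, ← mul_assoc, mul_div_mul_right _ _ (pow_ne_zero 2 hpos.ne')]

theorem measureReal_exists_le_sum_floor_le (hτ : 0 ≤ τ) {x : ι → ℝ} (hx : ∀ j, 0 ≤ x j) (k : ℕ)
    {T : ℝ} (hT : 0 < T) :
    (Measure.pi fun _ : Fin k => Measure.pi fun _ : ι => μ).real
      {ω | ∃ q, T ≤ ∑ j, x j * ⌊Z (ω q j) / τ⌋₊} ≤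
        k * ((∑ j, x j) * (Real.log (2 * N / τ ^ 2) / τ)) / T := by
  have hterm (j : ι) : Integrable (fun ω : ι → Ω => x j * (Z (ω j) / τ))
      (Measure.pi fun _ : ι => μ) :=
    ((integrable_comp_eval (μ := fun _ : ι => μ) hZ.integrable).div_const τ).const_mul _
  have hmean : ∫ ω : ι → Ω, ∑ j, x j * (Z (ω j) / τ) ∂(Measure.pi fun _ : ι => μ) =
      (∑ j, x j) * (Real.log (2 * N / τ ^ 2) / τ) := by
    rw [integral_finsetSum _ fun j _ => hterm j, Finset.sum_mul]
    refine Finset.sum_congr rfl fun j _ => ?_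
    rw [integral_const_mul, integral_div,
      integral_comp_eval (μ := fun _ : ι => μ) hZ.measurable.aestronglyMeasurable, hZ.integral_eq]
  rw [← hmean]
  refine (measureReal_mono ?_).trans (measureReal_exists_ge_le
    (fun ω => Finset.sum_nonneg fun j _ => mul_nonneg (hx j) (div_nonneg (hZ.nonneg _) hτ))
    (integrable_finsetSum _ fun j _ => hterm j) k hT)
  rintro ω ⟨q, hq⟩
  exact ⟨q, hq.trans (Finset.sum_le_sum fun j _ => mul_le_mul_of_nonneg_left
    (Nat.floor_le (div_nonneg (hZ.nonneg _) hτ)) (hx j))⟩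

end IsEntropySketch

end Statistics

/-! ### Recovering the entropy -/

section Estimate

theorem exp_neg_le_of_mul_sub_le {s s' τ η L : ℝ} (hη₀ : 0 ≤ η) (hη₁ : η ≤ 1) (hτ : 0 ≤ τ)
    (hηL : η * L ≤ τ) (hs : (1 - η) * (s - τ) ≤ s') :
    Real.exp (-s') ≤ Real.exp (2 * τ) * (Real.exp (-s) + Real.exp (-L)) := by
  have hmin : min s L - 2 * τ ≤ s' := by
    have hmul : (1 - η) * (min s L - τ) ≤ (1 - η) * (s - τ) :=
      mul_le_mul_of_nonneg_left (sub_le_sub_right (min_le_left s L) τ) (sub_nonneg.2 hη₁)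
    have hηmin : η * min s L ≤ τ := (mul_le_mul_of_nonneg_left (min_le_right s L) hη₀).trans hηL
    linarith [mul_nonneg hη₀ hτ]
  calc Real.exp (-s') ≤ Real.exp (2 * τ) * Real.exp (-min s L) := by
        rw [← Real.exp_add, Real.exp_le_exp]
        linarith
    _ ≤ Real.exp (2 * τ) * (Real.exp (-s) + Real.exp (-L)) := by
        gcongr
        rcases min_choice s L with h | h <;> rw [h] <;>
          linarith [Real.exp_pos (-s), Real.exp_pos (-L)]

theorem exp_neg_le_of_le_mul {s s' τ η L : ℝ} (hη : 0 ≤ η) (hτ : 0 ≤ τ) (hηL : η * L ≤ τ)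
    (hs : s' ≤ (1 + η) * s) :
    Real.exp (-s) ≤ Real.exp τ * (Real.exp (-s') + Real.exp (-L)) := by
  rcases le_total s L with hsL | hLs
  · have hηs : η * s ≤ τ := (mul_le_mul_of_nonneg_left hsL hη).trans hηL
    calc Real.exp (-s) ≤ Real.exp τ * Real.exp (-s') := by
          rw [← Real.exp_add, Real.exp_le_exp]
          linarith
      _ ≤ _ := by
          gcongr
          exact le_add_of_nonneg_right (Real.exp_pos _).le
  · calc Real.exp (-s) ≤ Real.exp (-s') + Real.exp (-L) :=
          le_add_of_nonneg_of_le (Real.exp_pos _).le (Real.exp_le_exp.2 (neg_le_neg hLs))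
      _ ≤ _ := le_mul_of_one_le_left (by positivity) (Real.one_le_exp hτ)

theorem average_le_mul_average_add {k : ℕ} (hk : k ≠ 0) {f g : Fin k → ℝ} {c l : ℝ}
    (hfg : ∀ q, f q ≤ c * (g q + l)) : (∑ q, f q) / k ≤ c * ((∑ q, g q) / k + l) := by
  have hk₀ : (0 : ℝ) < k := Nat.cast_pos.2 (Nat.pos_of_ne_zero hk)
  rw [div_le_iff₀ hk₀]
  refine (Finset.sum_le_sum fun q _ => hfg q).trans_eq ?_
  rw [← Finset.mul_sum, Finset.sum_add_distrib, Finset.sum_const, Finset.card_univ,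
    Fintype.card_fin, nsmul_eq_mul]
  field_simp

theorem log_le_log_add_of_le_exp_mul {A A' m τ l : ℝ} (hm : 0 < m) (hA' : 0 < A')
    (hl : l ≤ τ * m) (hAm : A ≤ (1 + τ) * m) (hle : A' ≤ Real.exp (2 * τ) * (A + l)) :
    Real.log A' ≤ Real.log m + 4 * τ := by
  have hsum : A + l ≤ Real.exp (2 * τ) * m :=
    calc A + l ≤ (2 * τ + 1) * m := by linarith
      _ ≤ Real.exp (2 * τ) * m := mul_le_mul_of_nonneg_right (Real.add_one_le_exp _) hm.le
  have hupper : A' ≤ Real.exp (4 * τ) * m :=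
    calc A' ≤ Real.exp (2 * τ) * (Real.exp (2 * τ) * m) :=
          hle.trans (mul_le_mul_of_nonneg_left hsum (Real.exp_pos _).le)
      _ = Real.exp (4 * τ) * m := by rw [← mul_assoc, ← Real.exp_add]; ring_nf
  have hlog := Real.log_le_log hA' hupper
  rw [Real.log_mul (Real.exp_pos _).ne' hm.ne', Real.log_exp] at hlog
  linarith

theorem mul_le_of_le_exp_mul {A A' m τ l : ℝ} (hτ : τ ≤ 1) (hm : 0 < m)
    (hl : l ≤ τ * m) (hAm : (1 - τ) * m ≤ A) (hle : A ≤ Real.exp τ * (A' + l)) :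
    (1 - 3 * τ) * m ≤ A' := by
  have hexp : Real.exp (-τ) * A ≤ A' + l := by
    rw [Real.exp_neg, inv_mul_le_iff₀ (Real.exp_pos τ)]
    exact hle
  have hlower : (1 - τ) * ((1 - τ) * m) ≤ Real.exp (-τ) * A :=
    mul_le_mul (by linarith [Real.add_one_le_exp (-τ)]) hAm
      (mul_nonneg (sub_nonneg.2 hτ) hm.le) (Real.exp_pos _).le
  nlinarith [mul_nonneg (sq_nonneg τ) hm.le]

theorem abs_log_sub_log_le {A A' m τ l : ℝ} (hτ₀ : 0 ≤ τ) (hτ : τ ≤ 1 / 40) (hm : 0 < m)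
    (hl : l ≤ τ * m) (hAm : |A - m| ≤ τ * m) (hA' : A' ≤ Real.exp (2 * τ) * (A + l))
    (hA : A ≤ Real.exp τ * (A' + l)) : |Real.log A' - Real.log m| ≤ 6 * τ := by
  obtain ⟨hAm_lower, hAm_upper⟩ := abs_le.1 hAm
  have hfactor : 0 < 1 - 3 * τ := by linarith
  have hlower : (1 - 3 * τ) * m ≤ A' :=
    mul_le_of_le_exp_mul (by linarith) hm hl (by linarith) hA
  have hupper : Real.log A' ≤ Real.log m + 4 * τ :=
    log_le_log_add_of_le_exp_mul hm ((mul_pos hfactor hm).trans_le hlower) hl (by linarith) hA'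
  have hlog_lower : Real.log (1 - 3 * τ) + Real.log m ≤ Real.log A' := by
    rw [← Real.log_mul hfactor.ne' hm.ne']
    exact Real.log_le_log (mul_pos hfactor hm) hlower
  have hinv : (1 - 3 * τ)⁻¹ ≤ 1 + 6 * τ := by
    rw [inv_le_iff_one_le_mul₀ hfactor]
    nlinarith
  have hlog_factor := Real.one_sub_inv_le_log_of_pos hfactor
  rw [abs_le]
  constructor <;> linarith

theorem mul_div_le_of_abs_sub_le {W S T V V' τ η : ℝ} (hτ : 0 ≤ τ) (hη₀ : 0 ≤ η)
    (hη : 3 * η ≤ 1) (hW : 0 < W) (hS : 0 ≤ S) (hT : τ * T ≤ W * S) (hV : |V - T| ≤ η * T)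
    (hV' : |V' - W| ≤ η * W) : τ * V / V' ≤ (1 + 3 * η) * S := by
  have hV'_lower : (1 - η) * W ≤ V' := by linarith [(abs_le.1 hV').1]
  have hV'_pos : 0 < V' := (mul_pos (by linarith) hW).trans_le hV'_lower
  have hfactor : 1 + η ≤ (1 + 3 * η) * (1 - η) := by nlinarith
  rw [div_le_iff₀ hV'_pos]
  calc τ * V ≤ τ * ((1 + η) * T) := by
        gcongr
        linarith [(abs_le.1 hV).2]
    _ = (1 + η) * (τ * T) := by ring
    _ ≤ (1 + η) * (W * S) := by gcongr
    _ ≤ (1 + 3 * η) * (1 - η) * (W * S) := by gcongr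
    _ = (1 + 3 * η) * S * ((1 - η) * W) := by ring
    _ ≤ (1 + 3 * η) * S * V' := by gcongr

theorem le_mul_div_of_abs_sub_le {W S T V V' τ η : ℝ} (hτ : 0 ≤ τ) (hη₀ : 0 ≤ η)
    (hη : 3 * η ≤ 1) (hW : 0 < W) (hT₀ : 0 ≤ T) (hT : W * (S - τ) ≤ τ * T)
    (hV : |V - T| ≤ η * T) (hV' : |V' - W| ≤ η * W) :
    (1 - 3 * η) * (S - τ) ≤ τ * V / V' := by
  have hV'_lower : (1 - η) * W ≤ V' := by linarith [(abs_le.1 hV').1]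
  have hV'_pos : 0 < V' := (mul_pos (by linarith) hW).trans_le hV'_lower
  have hV_lower : (1 - η) * T ≤ V := by linarith [(abs_le.1 hV).1]
  rcases le_total S τ with hSτ | hτS
  · refine (mul_nonpos_of_nonneg_of_nonpos (by linarith) (sub_nonpos.2 hSτ)).trans ?_
    exact div_nonneg (mul_nonneg hτ ((mul_nonneg (by linarith) hT₀).trans hV_lower)) hV'_pos.le
  have hfactor : (1 - 3 * η) * (1 + η) ≤ 1 - η := by nlinarith
  have hS₀ : 0 ≤ S - τ := sub_nonneg.2 hτS
  rw [le_div_iff₀ hV'_pos]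
  calc (1 - 3 * η) * (S - τ) * V' ≤ (1 - 3 * η) * (S - τ) * ((1 + η) * W) := by
        refine mul_le_mul_of_nonneg_left ?_ (mul_nonneg (by linarith) hS₀)
        linarith [(abs_le.1 hV').2]
    _ = (1 - 3 * η) * (1 + η) * (W * (S - τ)) := by ring
    _ ≤ (1 - η) * (τ * T) :=
        mul_le_mul hfactor hT (mul_nonneg hW.le hS₀) (by linarith)
    _ = τ * ((1 - η) * T) := by ring
    _ ≤ τ * V := by gcongr

variable {ι : Type*} [Fintype ι]

/-- The probability vector proportional to `x`; it vanishes when the sum of `x` does. -/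
def weights (x : ι → ℝ) (j : ι) : ℝ := x j / ∑ i, x i

theorem isWeightVector_weights {N : ℝ} {x : ι → ℝ} (hx : ∀ j, x j = 0 ∨ 1 ≤ x j)
    (hsum : 0 < ∑ j, x j) (hN : ∑ j, x j ≤ N) : IsWeightVector N (weights x) where
  eq_zero_or j := by
    refine (hx j).imp (fun hj => by rw [weights, hj, zero_div]) fun hj => ?_
    rw [weights]
    gcongr
  sum_eq_one := by
    simp only [weights]
    rw [← Finset.sum_div, div_self hsum.ne']

theorem sum_mul_sum_weights_mul {x : ι → ℝ} (hsum : ∑ j, x j ≠ 0) (z : ι → ℝ) :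
    (∑ j, x j) * ∑ j, weights x j * z j = ∑ j, x j * z j := by
  rw [Finset.mul_sum]
  refine Finset.sum_congr rfl fun j _ => ?_
  rw [weights, ← mul_assoc, mul_div_cancel₀ _ hsum]

theorem shannonEntropy_eq_neg_sum_weights {n : ℕ} {x : Fin n → ℝ} (hx : ∀ j, 0 ≤ x j) :
    shannonEntropy x = -∑ j, weights x j * Real.log (weights x j) := by
  have hnorm : ∑ i, |x i| = ∑ i, x i := Finset.sum_congr rfl fun j _ => abs_of_nonneg (hx j)
  rw [shannonEntropy, hnorm, ← Finset.sum_neg_distrib]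
  refine Finset.sum_congr rfl fun j _ => ?_
  rw [abs_of_nonneg (hx j), ← inv_div (x j), Real.log_inv, weights, mul_neg]

theorem IsWeightVector.neg_log_le_sum_mul_log {N : ℝ} {p : ι → ℝ} (hp : IsWeightVector N p)
    (hN : 0 < N) : -Real.log N ≤ ∑ j, p j * Real.log (p j) := by
  calc -Real.log N = ∑ j, p j * -Real.log N := by rw [← Finset.sum_mul, hp.sum_eq_one, one_mul]
    _ ≤ ∑ j, p j * Real.log (p j) := by
      refine Finset.sum_le_sum fun j _ => ?_
      rcases hp.eq_zero_or j with hj | hj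
      · rw [hj, zero_mul, zero_mul]
      · refine mul_le_mul_of_nonneg_left ?_ (hp.nonneg hN.le j)
        rw [← Real.log_inv, ← one_div]
        exact Real.log_le_log (one_div_pos.2 hN) hj

theorem mul_sum_mul_floor_le {τ : ℝ} (hτ : 0 < τ) {x z : ι → ℝ} (hx : ∀ j, 0 ≤ x j)
    (hz : ∀ j, 0 ≤ z j) : τ * ∑ j, x j * ⌊z j / τ⌋₊ ≤ ∑ j, x j * z j := by
  rw [Finset.mul_sum]
  refine Finset.sum_le_sum fun j _ => ?_
  rw [mul_left_comm]
  refine mul_le_mul_of_nonneg_left ?_ (hx j)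
  rw [← le_div_iff₀' hτ]
  exact Nat.floor_le (div_nonneg (hz j) hτ.le)

theorem sum_mul_sub_le_mul_sum_mul_floor {τ : ℝ} (hτ : 0 < τ) {x : ι → ℝ} (hx : ∀ j, 0 ≤ x j)
    (z : ι → ℝ) : ∑ j, x j * (z j - τ) ≤ τ * ∑ j, x j * ⌊z j / τ⌋₊ := by
  rw [Finset.mul_sum]
  refine Finset.sum_le_sum fun j _ => ?_
  rw [mul_left_comm]
  refine mul_le_mul_of_nonneg_left ?_ (hx j)
  have hfloor := (div_lt_iff₀' hτ).1 (Nat.lt_floor_add_one (z j / τ))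
  linarith

/-- The parameters of the entropy protocol on `m` players, for aggregate vectors of `ℓ¹`-norm at
most `N`, with the constraints that make it work. -/
structure EntropyParameters (N : ℝ) (m : ℕ) where
  /-- The resolution of the sketches; the entropy is estimated to within `8 * τ`. -/
  τ : ℝ
  /-- Values of a sketch beyond `L` have a negligible exponential. -/
  L : ℝ
  /-- The relative error that rounding along the tree may cause. -/
  η : ℝ
  /-- Partial sums are rounded to powers of `1 + γ`. -/
  γ : ℝ
  /-- An upper bound for the registers. -/
  T : ℝ
  /-- An upper bound for the rounded partial sums. -/
  R : ℝ
  /-- The number of sketches. -/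
  k : ℕ
  /-- The number of bits that encode a rounded partial sum. -/
  b : ℕ
  one_le_N : 1 ≤ N
  τ_pos : 0 < τ
  τ_le : τ ≤ 1 / 40
  η_pos : 0 < η
  γ_pos : 0 < γ
  R_pos : 0 < R
  one_le_L : 1 ≤ L
  le_L : Real.log N + Real.log (2 / τ) + 1 + Real.log (1 / τ) ≤ L
  η_mul_L_le : 3 * η * L ≤ τ
  le_k : 100 / τ ^ 2 ≤ k
  γ_div_le : (k + 1) * (γ / η ^ 2) ≤ 1 / 40
  N_le_T : N ≤ T
  le_T : 40 * (k * (N * (Real.log (2 * N / τ ^ 2) / τ))) ≤ T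
  T_div_le : (k + 1) * (m * T / R) ≤ 1 / 40
  R_le : R ≤ (1 + γ) ^ (2 ^ b - 1)

namespace EntropyParameters

variable {N : ℝ} {m : ℕ} (c : EntropyParameters N m)

include c in
theorem N_pos : 0 < N := zero_lt_one.trans_le c.one_le_N

theorem three_mul_η_pos : 0 < 3 * c.η := mul_pos three_pos c.η_pos

theorem three_mul_η_le_one : 3 * c.η ≤ 1 :=
  calc 3 * c.η ≤ 3 * c.η * c.L := le_mul_of_one_le_right c.three_mul_η_pos.le c.one_le_L
    _ ≤ c.τ := c.η_mul_L_le
    _ ≤ 1 := c.τ_le.trans (by norm_num)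

theorem k_ne_zero : c.k ≠ 0 := by
  have hk : (0 : ℝ) < c.k := (div_pos (by norm_num) (pow_pos c.τ_pos 2)).trans_le c.le_k
  exact Nat.cast_ne_zero.1 hk.ne'

variable {Ω : Type*}

/-- The linear functionals of the aggregate vector that the protocol evaluates: register `none` is
the `ℓ¹`-norm and register `some q` the `q`-th sketch, rounded down to a multiple of `τ` in every
coordinate and expressed in units of `τ`. -/
def register (Z : Ω → ℝ) (ω : Fin c.k → ι → Ω) (x : ι → ℝ) : Option (Fin c.k) → ℝ
  | none => ∑ j, x j
  | some q => ∑ j, x j * ⌊Z (ω q j) / c.τ⌋₊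

/-- The estimate of the entropy that is computed from approximations `V` of the registers. -/
def estimate (V : Option (Fin c.k) → ℝ) : ℝ :=
  -Real.log ((∑ q, Real.exp (-(c.τ * V (some q) / V none))) / c.k) - Real.log (2 / c.τ)

theorem exp_neg_quotient_near {Z : Ω → ℝ} (hZ : ∀ w, 0 ≤ Z w) {x : ι → ℝ} (hx : ∀ j, 0 ≤ x j)
    (hsum : 0 < ∑ j, x j) {ω : Fin c.k → ι → Ω} {V : Option (Fin c.k) → ℝ}
    (hV : ∀ r, |V r - c.register Z ω x r| ≤ c.η * c.register Z ω x r) (q : Fin c.k) :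
    Real.exp (-(c.τ * V (some q) / V none)) ≤
        Real.exp (2 * c.τ) * (expSketch Z (weights x) (ω q) + Real.exp (-c.L)) ∧
      expSketch Z (weights x) (ω q) ≤
        Real.exp c.τ * (Real.exp (-(c.τ * V (some q) / V none)) + Real.exp (-c.L)) := by
  have hsketch := sum_mul_sum_weights_mul hsum.ne' fun j => Z (ω q j)
  have hsketch₀ : 0 ≤ ∑ j, weights x j * Z (ω q j) :=
    Finset.sum_nonneg fun j _ => mul_nonneg (div_nonneg (hx j) hsum.le) (hZ _)
  have hregister₀ : 0 ≤ ∑ j, x j * ⌊Z (ω q j) / c.τ⌋₊ :=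
    Finset.sum_nonneg fun j _ => mul_nonneg (hx j) (Nat.cast_nonneg _)
  constructor
  · refine exp_neg_le_of_mul_sub_le c.three_mul_η_pos.le c.three_mul_η_le_one c.τ_pos.le
      c.η_mul_L_le (le_mul_div_of_abs_sub_le c.τ_pos.le c.η_pos.le c.three_mul_η_le_one hsum
        hregister₀ ?_ (hV (some q)) (hV none))
    rw [mul_sub, hsketch, Finset.sum_mul, ← Finset.sum_sub_distrib]
    simp_rw [← mul_sub]
    exact sum_mul_sub_le_mul_sum_mul_floor c.τ_pos hx _
  · refine exp_neg_le_of_le_mul c.three_mul_η_pos.le c.τ_pos.le c.η_mul_L_le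
      (mul_div_le_of_abs_sub_le c.τ_pos.le c.η_pos.le c.three_mul_η_le_one hsum hsketch₀ ?_
        (hV (some q)) (hV none))
    rw [hsketch]
    exact mul_sum_mul_floor_le c.τ_pos hx fun j => hZ _

variable [MeasurableSpace Ω] {μ : Measure Ω} [IsProbabilityMeasure μ] {Z : Ω → ℝ}

theorem exp_neg_L_le (hZ : IsEntropySketch Z μ N c.τ) {p : ι → ℝ} (hp : IsWeightVector N p) :
    Real.exp (-c.L) ≤ c.τ * sketchMean μ Z p := by
  have hpos := hZ.sketchMean_pos (hp.nonneg c.N_pos.le)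
  have hL := c.le_L
  rw [one_div, Real.log_inv] at hL
  rw [← Real.le_log_iff_exp_le (mul_pos c.τ_pos hpos), Real.log_mul c.τ_pos.ne' hpos.ne']
  linarith [(abs_le.1 (hZ.abs_log_sketchMean_sub_le c.N_pos.le hp)).1,
    hp.neg_log_le_sum_mul_log c.N_pos, c.τ_le]

theorem abs_estimate_sub_le (hZ : IsEntropySketch Z μ N c.τ) {n : ℕ} {x : Fin n → ℝ}
    (hx : ∀ j, x j = 0 ∨ 1 ≤ x j) (hsum : 0 < ∑ j, x j) (hN : ∑ j, x j ≤ N)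
    {ω : Fin c.k → Fin n → Ω}
    (haverage : |(∑ q, expSketch Z (weights x) (ω q)) / c.k - sketchMean μ Z (weights x)| ≤
      c.τ * sketchMean μ Z (weights x)) {V : Option (Fin c.k) → ℝ}
    (hV : ∀ r, |V r - c.register Z ω x r| ≤ c.η * c.register Z ω x r) :
    |c.estimate V - shannonEntropy x| ≤ 8 * c.τ := by
  have hx₀ (j : Fin n) : 0 ≤ x j := (hx j).elim ge_of_eq zero_le_one.trans
  have hp := isWeightVector_weights hx hsum hN
  have hnear := c.exp_neg_quotient_near hZ.nonneg hx₀ hsum hV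
  have hlog := abs_log_sub_log_le c.τ_pos.le c.τ_le (hZ.sketchMean_pos (hp.nonneg c.N_pos.le))
    (c.exp_neg_L_le hZ hp) haverage
    (average_le_mul_average_add c.k_ne_zero fun q => (hnear q).1)
    (average_le_mul_average_add c.k_ne_zero fun q => (hnear q).2)
  rw [shannonEntropy_eq_neg_sum_weights hx₀, estimate]
  obtain ⟨hlog_lower, hlog_upper⟩ := abs_le.1 hlog
  obtain ⟨hmean_lower, hmean_upper⟩ := abs_le.1 (hZ.abs_log_sketchMean_sub_le c.N_pos.le hp)
  rw [abs_le]
  constructor <;> linarith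

end EntropyParameters

end Estimate

/-! ### The entropy protocol -/

theorem RootedTree.fold_pi {V Q A : Type*} [Fintype V] [DecidableEq V] (S : RootedTree V)
    (step : Q → ∀ u, (S.children u → A) → A) (u : V) :
    S.fold (fun v (f : S.children v → Q → A) r => step r v fun w => f w r) u =
      fun r => S.fold (step r) u := by
  induction u using S.induction_children with
  | h u ih =>
    funext r
    rw [fold_eq, fold_eq]
    congr 1
    funext w
    exact congrFun (ih w w.2) r

theorem exists_tuple_encoding (Q : Type*) [Fintype Q] (b : ℕ) :
    ∃ (enc : (Q → ℕ) → List Bool) (dec : List Bool → Q → ℕ),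
      (∀ a, (enc a).length = Fintype.card Q * b) ∧
        ∀ a, (∀ r, a r < 2 ^ b) → dec (enc a) = a := by
  classical
  let e : (Q → Fin (2 ^ b)) ≃ (Fin (Fintype.card Q * b) → Bool) := Fintype.equivOfCardEq (by
    simp [← pow_mul, mul_comm])
  have hinj : Function.Injective fun a => List.ofFn (e a) :=
    fun a a' h => e.injective (List.ofFn_injective h)
  refine ⟨fun a => List.ofFn (e fun r => ⟨a r % 2 ^ b, Nat.mod_lt _ (by positivity)⟩),
    fun l r => Function.invFun (fun a => List.ofFn (e a)) l r, fun a => List.length_ofFn,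
    fun a ha => ?_⟩
  have hinv := Function.leftInverse_invFun hinj fun r => ⟨a r % 2 ^ b, Nat.mod_lt _ (by positivity)⟩
  exact funext fun r => (congrArg Fin.val (congrFun hinv r)).trans (Nat.mod_eq_of_lt (ha r))

section Probability

theorem measureReal_prod_union_le {α β : Type*} [MeasurableSpace α] [MeasurableSpace β]
    {μ : Measure α} {ν : Measure β} [IsProbabilityMeasure μ] [IsProbabilityMeasure ν]
    {A : Set (α × β)} (hA : MeasurableSet A) {B : Set α} {p : ℝ} (hp : 0 ≤ p)
    (h : ∀ x ∉ B, ν.real (Prod.mk x ⁻¹' A) ≤ p) :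
    (μ.prod ν).real (Prod.fst ⁻¹' B ∪ A) ≤ μ.real B + p := by
  set B' := toMeasurable μ B
  have hB' : MeasurableSet B' := measurableSet_toMeasurable μ B
  have hsub : Prod.fst ⁻¹' B ∪ A ⊆ Prod.fst ⁻¹' B' ∪ (A \ Prod.fst ⁻¹' B') := by
    rw [Set.union_sdiff_self]
    exact Set.union_subset_union_left A (Set.preimage_mono (subset_toMeasurable μ B))
  have hfst : (μ.prod ν).real (Prod.fst ⁻¹' B') = μ.real B := by
    rw [measureReal_def, measurePreserving_fst.measure_preimage hB'.nullMeasurableSet,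
      measure_toMeasurable, measureReal_def]
  have hsection (x : α) :
      ν (Prod.mk x ⁻¹' (A \ Prod.fst ⁻¹' B')) ≤ ENNReal.ofReal p := by
    by_cases hx : x ∈ B'
    · have hempty : Prod.mk x ⁻¹' (A \ Prod.fst ⁻¹' B') = ∅ :=
        Set.eq_empty_of_forall_notMem fun y hy => hy.2 hx
      rw [hempty, measure_empty]
      exact zero_le
    · refine (measure_mono (Set.preimage_mono Set.sdiff_subset)).trans ?_
      rw [← ofReal_measureReal]
      exact ENNReal.ofReal_le_ofReal (h x fun hxB => hx (subset_toMeasurable μ B hxB))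
  have hdiff : (μ.prod ν).real (A \ Prod.fst ⁻¹' B') ≤ p := by
    refine ENNReal.toReal_le_of_le_ofReal hp ?_
    rw [Measure.prod_apply (hA.diff (measurable_fst hB'))]
    refine (lintegral_mono hsection).trans ?_
    rw [lintegral_const, measure_univ, mul_one]
  calc (μ.prod ν).real (Prod.fst ⁻¹' B ∪ A)
      ≤ (μ.prod ν).real (Prod.fst ⁻¹' B') + (μ.prod ν).real (A \ Prod.fst ⁻¹' B') :=
        (measureReal_mono hsub).trans (measureReal_union_le _ _)
    _ ≤ μ.real B + p := by rw [hfst]; gcongr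

theorem measureReal_exists_rounding_error_le {V Q : Type*} [Fintype V] [DecidableEq V] [Fintype Q]
    (S : RootedTree V) {g η R T : ℝ} (hg : 1 < g) (hη : 0 < η) (hR : 0 < R) {a : Q → V → ℝ}
    (ha : ∀ r u, a r u = 0 ∨ 1 ≤ a r u) (haT : ∀ r, ∑ u, a r u ≤ T) :
    (Measure.pi fun _ : Q => RootedTree.thresholdLaw V).real
      {θ | ∃ r, η * ∑ u, a r u < |S.rounded g (a r) S.root (θ r) - ∑ u, a r u| ∨
        ∃ u, R ≤ S.rounded g (a r) u (θ r)} ≤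
      Fintype.card Q * ((g - 1) / η ^ 2 + Fintype.card V * T / R) := by
  set A : Q → Set (V → ℝ) := fun r =>
    {θ | η * ∑ u, a r u < |S.rounded g (a r) S.root θ - ∑ u, a r u|} ∪
      {θ | ∃ u, R ≤ S.rounded g (a r) u θ}
  have hA (r : Q) : MeasurableSet (A r) := by
    refine (measurableSet_lt measurable_const
      ((S.measurable_rounded g (a r) S.root).sub_const _).abs).union ?_
    rw [Set.ofPred_exists]
    exact MeasurableSet.iUnion fun u =>
      measurableSet_le measurable_const (S.measurable_rounded g (a r) u)
  have hbound (r : Q) : (Measure.pi fun _ : Q => RootedTree.thresholdLaw V).real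
      {θ | θ r ∈ A r} ≤ (g - 1) / η ^ 2 + Fintype.card V * T / R := by
    have hpreimage := (measurePreserving_eval (fun _ : Q => RootedTree.thresholdLaw V)
      r).measureReal_preimage (hA r).nullMeasurableSet
    refine hpreimage.trans_le ((measureReal_union_le _ _).trans (add_le_add
      (S.measureReal_rounded_root_le hg (ha r) hη)
      ((S.measureReal_exists_le_rounded_le hg (ha r) hR).trans ?_)))
    gcongr
    exact haT r
  rw [Set.ofPred_exists]
  refine (measureReal_iUnion_fintype_le _).trans
    ((Finset.sum_le_sum fun r _ => hbound r).trans_eq ?_)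
  rw [Finset.sum_const, nsmul_eq_mul, Finset.card_univ]

end Probability

theorem natCast_eq_zero_or_one_le (a : ℕ) : (a : ℝ) = 0 ∨ 1 ≤ (a : ℝ) := by
  exact_mod_cast Nat.eq_zero_or_pos a

section Aggregate

variable {n m M : ℕ} (X : Fin m → Fin n → Fin (M + 1))

theorem aggregate_eq_zero_or (j : Fin n) : aggregate X j = 0 ∨ 1 ≤ aggregate X j :=
  sum_eq_zero_or_one_le fun _ _ => natCast_eq_zero_or_one_le _

theorem sum_aggregate_le : ∑ j, aggregate X j ≤ (n : ℝ) * m * M := by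
  have hentry (i : Fin m) (j : Fin n) : ((X i j : ℕ) : ℝ) ≤ M :=
    Nat.cast_le.2 (Nat.lt_succ_iff.1 (X i j).2)
  calc ∑ j, aggregate X j ≤ ∑ _j : Fin n, ∑ _i : Fin m, (M : ℝ) :=
        Finset.sum_le_sum fun j _ => Finset.sum_le_sum fun i _ => hentry i j
    _ = (n : ℝ) * m * M := by simp [mul_assoc]

variable {X} in
theorem sum_aggregate_pos (hX : aggregate X ≠ 0) : 0 < ∑ j, aggregate X j := by
  have hnonneg (j : Fin n) : 0 ≤ aggregate X j := Finset.sum_nonneg fun _ _ => Nat.cast_nonneg _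
  obtain ⟨j, hj⟩ := Function.ne_iff.1 hX
  exact Finset.sum_pos' (fun j _ => hnonneg j) ⟨j, Finset.mem_univ j, (hnonneg j).lt_of_ne' hj⟩

end Aggregate

namespace EntropyParameters

variable {N : ℝ} {m : ℕ} (c : EntropyParameters N m) {Ω ι : Type*} [Fintype ι]
  (S : RootedTree (Fin m)) (Z : Ω → ℝ)

theorem one_lt_one_add_γ : 1 < 1 + c.γ := lt_add_of_pos_right 1 c.γ_pos

section Register

theorem register_eq_zero_or (ω : Fin c.k → ι → Ω) {x : ι → ℝ} (hx : ∀ j, x j = 0 ∨ 1 ≤ x j)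
    (r : Option (Fin c.k)) : c.register Z ω x r = 0 ∨ 1 ≤ c.register Z ω x r := by
  cases r with
  | none => exact sum_eq_zero_or_one_le fun j _ => hx j
  | some q =>
    refine sum_eq_zero_or_one_le fun j _ => ?_
    rcases hx j with hj | hj
    · exact Or.inl (by rw [hj, zero_mul])
    · exact (natCast_eq_zero_or_one_le ⌊Z (ω q j) / c.τ⌋₊).imp (fun h => by rw [h, mul_zero])
        (one_le_mul_of_one_le_of_one_le hj)

theorem sum_register {κ : Type*} [Fintype κ] (ω : Fin c.k → ι → Ω) (x : κ → ι → ℝ)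
    (r : Option (Fin c.k)) :
    ∑ u, c.register Z ω (x u) r = c.register Z ω (fun j => ∑ u, x u j) r := by
  cases r with
  | none => exact Finset.sum_comm
  | some q =>
    simp only [register, Finset.sum_mul]
    exact Finset.sum_comm

variable {Z} in
theorem measurable_register [MeasurableSpace Ω] (hZ : Measurable Z) (x : ι → ℝ)
    (r : Option (Fin c.k)) : Measurable fun ω : Fin c.k → ι → Ω => c.register Z ω x r := by
  cases r with
  | none => exact measurable_const
  | some q =>
    refine Finset.measurable_fun_sum _ fun j _ => Measurable.const_mul ?_ (x j)
    exact measurable_from_top.comp (Nat.measurable_floor.comp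
      ((hZ.comp ((measurable_pi_apply j).comp (measurable_pi_apply q))).div_const c.τ))

end Register

section Sample

/-- The randomness of the entropy protocol: arguments for the sketches, and a threshold for every
register and player. -/
abbrev Sample (Ω ι : Type*) : Type _ :=
  (Fin c.k → ι → Ω) × (Option (Fin c.k) → Fin m → ℝ)

/-- The law of the randomness of the entropy protocol. -/
abbrev sampleLaw (ι : Type*) [Fintype ι] [MeasurableSpace Ω] (μ : Measure Ω) :
    Measure (c.Sample Ω ι) :=
  (Measure.pi fun _ => Measure.pi fun _ => μ).prod
    (Measure.pi fun _ => RootedTree.thresholdLaw (Fin m))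

/-- The approximation of the part of register `r` that stems from the descendants of player `u`,
when player `v` holds the vector `x v`. -/
def roundedRegister (ω : c.Sample Ω ι) (x : Fin m → ι → ℝ) (r : Option (Fin c.k)) (u : Fin m) : ℝ :=
  S.rounded (1 + c.γ) (fun v => c.register Z ω.1 (x v) r) u (ω.2 r)

/-- The sketches fail to estimate the entropy of `x`, or one of their registers is too large. -/
def badSketch [MeasurableSpace Ω] (μ : Measure Ω) (x : ι → ℝ) : Set (Fin c.k → ι → Ω) :=
  {ω | c.τ * sketchMean μ Z (weights x) ≤
      |(∑ q, expSketch Z (weights x) (ω q)) / c.k - sketchMean μ Z (weights x)|} ∪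
    {ω | ∃ q, c.T ≤ c.register Z ω x (some q)}

/-- A rounded register is inaccurate at the root, or too large at some player. -/
def badRounding (x : Fin m → ι → ℝ) : Set (c.Sample Ω ι) :=
  {ω | ∃ r, c.η * ∑ u, c.register Z ω.1 (x u) r <
      |c.roundedRegister S Z ω x r S.root - ∑ u, c.register Z ω.1 (x u) r| ∨
    ∃ u, c.R ≤ c.roundedRegister S Z ω x r u}

variable [MeasurableSpace Ω] {μ : Measure Ω} {Z}

theorem measurable_roundedRegister (hZ : Measurable Z) (x : Fin m → ι → ℝ)
    (r : Option (Fin c.k)) (u : Fin m) :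
    Measurable fun ω : c.Sample Ω ι => c.roundedRegister S Z ω x r u :=
  S.measurable_rounded_comp (1 + c.γ)
    (measurable_pi_lambda _ fun v => (c.measurable_register hZ (x v) r).comp measurable_fst)
    ((measurable_pi_apply r).comp measurable_snd) u

theorem measurableSet_badRounding (hZ : Measurable Z) (x : Fin m → ι → ℝ) :
    MeasurableSet (c.badRounding S Z x) := by
  have hsum (r : Option (Fin c.k)) :
      Measurable fun ω : c.Sample Ω ι => ∑ u, c.register Z ω.1 (x u) r :=
    Finset.measurable_fun_sum _ fun u _ => (c.measurable_register hZ (x u) r).comp measurable_fst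
  have hlarge (r : Option (Fin c.k)) :
      MeasurableSet {ω : c.Sample Ω ι | ∃ u, c.R ≤ c.roundedRegister S Z ω x r u} := by
    rw [Set.ofPred_exists]
    exact MeasurableSet.iUnion fun u =>
      measurableSet_le measurable_const (c.measurable_roundedRegister S hZ x r u)
  rw [badRounding, Set.ofPred_exists]
  exact MeasurableSet.iUnion fun r => (measurableSet_lt ((hsum r).const_mul c.η)
    ((c.measurable_roundedRegister S hZ x r S.root).sub (hsum r)).abs).union (hlarge r)

theorem measureReal_badSketch_le [IsProbabilityMeasure μ] (hZ : IsEntropySketch Z μ N c.τ)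
    {x : ι → ℝ} (hx : ∀ j, x j = 0 ∨ 1 ≤ x j) (hsum : 0 < ∑ j, x j) (hN : ∑ j, x j ≤ N) :
    (Measure.pi fun _ : Fin c.k => Measure.pi fun _ : ι => μ).real (c.badSketch Z μ x) ≤
      3 / 40 := by
  have hT : 0 < c.T := c.N_pos.trans_le c.N_le_T
  have hk : 100 ≤ c.k * c.τ ^ 2 := (div_le_iff₀ (pow_pos c.τ_pos 2)).1 c.le_k
  have haverage : 5 / (c.k * c.τ ^ 2) ≤ 1 / 20 := by
    rw [div_le_iff₀ (by linarith)]
    linarith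
  have hmean : 0 ≤ Real.log (2 * N / c.τ ^ 2) :=
    hZ.integral_eq ▸ integral_nonneg hZ.nonneg
  have hlarge : c.k * ((∑ j, x j) * (Real.log (2 * N / c.τ ^ 2) / c.τ)) / c.T ≤ 1 / 40 := by
    have hle : c.k * ((∑ j, x j) * (Real.log (2 * N / c.τ ^ 2) / c.τ)) ≤
        c.k * (N * (Real.log (2 * N / c.τ ^ 2) / c.τ)) := by
      gcongr
      exact div_nonneg hmean c.τ_pos.le
    rw [div_le_iff₀ hT]
    linarith [c.le_T]
  refine (measureReal_union_le _ _).trans ?_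
  have hsketch := hZ.measureReal_average_expSketch_le c.N_pos.le c.τ_pos c.τ_le
    (isWeightVector_weights hx hsum hN) c.k_ne_zero
  have hfloor := hZ.measureReal_exists_le_sum_floor_le c.τ_pos.le
    (fun j => (hx j).elim ge_of_eq zero_le_one.trans) c.k hT
  exact (add_le_add (hsketch.trans haverage) (hfloor.trans hlarge)).trans_eq (by norm_num)

theorem measureReal_badRounding_section_le {x : Fin m → ι → ℝ}
    (hx : ∀ u j, x u j = 0 ∨ 1 ≤ x u j) (hN : ∑ j, ∑ u, x u j ≤ N) {ω : Fin c.k → ι → Ω}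
    (hω : ω ∉ c.badSketch Z μ fun j => ∑ u, x u j) :
    (Measure.pi fun _ => RootedTree.thresholdLaw (Fin m)).real
      (Prod.mk ω ⁻¹' c.badRounding S Z x) ≤ 1 / 20 := by
  have hle_T (r : Option (Fin c.k)) : ∑ u, c.register Z ω (x u) r ≤ c.T := by
    rw [sum_register]
    cases r with
    | none => exact hN.trans c.N_le_T
    | some q =>
      by_contra! hlt
      exact hω (Or.inr ⟨q, hlt.le⟩)
  refine (measureReal_exists_rounding_error_le S c.one_lt_one_add_γ c.η_pos c.R_pos
    (fun r u => c.register_eq_zero_or Z ω (hx u) r) hle_T).trans ?_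
  rw [Fintype.card_option, Fintype.card_fin, Fintype.card_fin, add_sub_cancel_left, mul_add,
    Nat.cast_add_one]
  linarith [c.γ_div_le, c.T_div_le]

theorem measureReal_bad_lt [IsProbabilityMeasure μ] (hZ : IsEntropySketch Z μ N c.τ)
    {x : Fin m → ι → ℝ} (hx : ∀ u j, x u j = 0 ∨ 1 ≤ x u j) (hsum : 0 < ∑ j, ∑ u, x u j)
    (hN : ∑ j, ∑ u, x u j ≤ N) :
    (c.sampleLaw ι μ).real
      (Prod.fst ⁻¹' c.badSketch Z μ (fun j => ∑ u, x u j) ∪ c.badRounding S Z x) < 1 / 4 :=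
  calc _ ≤ (Measure.pi fun _ => Measure.pi fun _ => μ).real
          (c.badSketch Z μ fun j => ∑ u, x u j) + 1 / 20 :=
        measureReal_prod_union_le (c.measurableSet_badRounding S hZ.measurable x) (by norm_num)
          fun ω hω => c.measureReal_badRounding_section_le S hx hN hω
    _ ≤ 3 / 40 + 1 / 20 := by
        gcongr
        exact c.measureReal_badSketch_le hZ
          (fun j => sum_eq_zero_or_one_le fun u _ => hx u j) hsum hN
    _ < 1 / 4 := by norm_num

end Sample

section Protocol

variable {n M L : ℕ} {G : SimpleGraph (Fin m)}

/-- The entropy protocol for the randomness `s`, a function of finitely many public coins: the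
rounded registers are accumulated along the spanning tree `S`, and the root outputs the estimate of
the entropy. A player sends the codes of its rounded registers, encoded as bits by `enc`. -/
def protocol (hS : ∀ u, u ≠ S.root → G.Adj u (S.parent u))
    (s : (Fin L → Bool) → c.Sample Ω (Fin n)) (enc : (Option (Fin c.k) → ℕ) → List Bool) {B : ℕ}
    (hlen : ∀ a, (enc a).length = B) (dec : List Bool → Option (Fin c.k) → ℕ) :
    Protocol G (Fin n → Fin (M + 1)) :=
  convergecast S hS enc hlen dec
    (fun σ u x f r => roundCode (1 + c.γ)
      (c.register Z (s σ).1 (fun j => ((x j : ℕ) : ℝ)) r + ∑ w, gridValue (1 + c.γ) (f w r))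
      ((s σ).2 r u))
    fun _ a => c.estimate fun r => gridValue (1 + c.γ) (a r)

variable (hS : ∀ u, u ≠ S.root → G.Adj u (S.parent u)) (s : (Fin L → Bool) → c.Sample Ω (Fin n))
  {enc : (Option (Fin c.k) → ℕ) → List Bool} {B : ℕ} (hlen : ∀ a, (enc a).length = B)
  {dec : List Bool → Option (Fin c.k) → ℕ}

theorem output_protocol (hdec : ∀ a, (∀ r, a r < 2 ^ c.b) → dec (enc a) = a)
    {X : Fin m → Fin n → Fin (M + 1)} {ω : Coins}
    (hR : ∀ r u, c.roundedRegister S Z (s (firstCoins L ω)) (fun v j => ((X v j : ℕ) : ℝ)) r u <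
      c.R) :
    (c.protocol S Z hS s enc hlen dec).output X ω =
      c.estimate fun r => c.roundedRegister S Z (s (firstCoins L ω))
        (fun v j => ((X v j : ℕ) : ℝ)) r S.root := by
  set θ := s (firstCoins L ω)
  have hfold (u : Fin m) := S.fold_pi (fun (r : Option (Fin c.k)) v f => roundCode (1 + c.γ)
    (c.register Z θ.1 (fun j => ((X v j : ℕ) : ℝ)) r + ∑ w, gridValue (1 + c.γ) (f w))
    (θ.2 r v)) u
  rw [protocol, output_convergecast S hS hlen]
  · rw [hfold]
    rfl
  · intro u
    rw [hfold]
    exact hdec _ fun r => (Nat.le_sub_one_iff_lt (by positivity)).1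
      (le_of_gridValue_lt_pow c.one_lt_one_add_γ ((hR r u).trans_le c.R_le))

end Protocol

section Estimate

variable {n M L : ℕ} {G : SimpleGraph (Fin m)} [MeasurableSpace Ω] {μ : Measure Ω}
  [IsProbabilityMeasure μ] {Z}

theorem abs_output_sub_shannonEntropy_le (hZ : IsEntropySketch Z μ N c.τ)
    (hS : ∀ u, u ≠ S.root → G.Adj u (S.parent u)) (s : (Fin L → Bool) → c.Sample Ω (Fin n))
    {enc : (Option (Fin c.k) → ℕ) → List Bool} {B : ℕ} (hlen : ∀ a, (enc a).length = B)
    {dec : List Bool → Option (Fin c.k) → ℕ}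
    (hdec : ∀ a, (∀ r, a r < 2 ^ c.b) → dec (enc a) = a)
    {X : Fin m → Fin n → Fin (M + 1)} (hX : aggregate X ≠ 0)
    (hN : ∑ j, aggregate X j ≤ N) {ω : Coins}
    (hω : s (firstCoins L ω) ∉ Prod.fst ⁻¹' c.badSketch Z μ (aggregate X) ∪
      c.badRounding S Z fun u j => ((X u j : ℕ) : ℝ)) :
    |(c.protocol S Z hS s enc hlen dec).output X ω - shannonEntropy (aggregate X)| ≤ 8 * c.τ := by
  obtain ⟨hsketch, hrounding⟩ := not_or.1 hω
  obtain ⟨haverage, -⟩ := not_or.1 hsketch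
  have hsmall (r : Option (Fin c.k)) (u : Fin m) :=
    not_le.1 fun h => hrounding ⟨r, Or.inr ⟨u, h⟩⟩
  have haccurate (r : Option (Fin c.k)) := not_lt.1 fun h => hrounding ⟨r, Or.inl h⟩
  rw [c.output_protocol S Z hS s hlen hdec hsmall]
  refine c.abs_estimate_sub_le hZ (aggregate_eq_zero_or X) (sum_aggregate_pos hX) hN
    (not_le.1 haverage).le fun r => ?_
  have hr := haccurate r
  rwa [sum_register] at hr

end Estimate

theorem exists_protocol {n M : ℕ} {G : SimpleGraph (Fin m)} (hG : G.Connected)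
    (hN : (n : ℝ) * m * M ≤ N) :
    ∃ P : Protocol G (Fin n → Fin (M + 1)),
      EstimatesEntropy P (8 * c.τ) ∧ P.maxCommunication ≤ 2 * ((c.k + 1) * c.b) := by
  obtain ⟨v⟩ := hG.nonempty
  obtain ⟨S, hS⟩ := exists_spanningTree hG v
  obtain ⟨Ω, _, μ, _, Z, hZ⟩ :=
    exists_isEntropySketch c.one_le_N c.τ_pos (c.τ_le.trans (by norm_num))
  obtain ⟨enc, dec, hlen, hdec⟩ := exists_tuple_encoding (Option (Fin c.k)) c.b
  have hsum_le (X : Fin m → Fin n → Fin (M + 1)) : ∑ j, aggregate X j ≤ N :=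
    (sum_aggregate_le X).trans hN
  let bad (X : {X : Fin m → Fin n → Fin (M + 1) // aggregate X ≠ 0}) : Set (c.Sample Ω (Fin n)) :=
    Prod.fst ⁻¹' c.badSketch Z μ (aggregate X.1) ∪
      c.badRounding S Z fun u j => ((X.1 u j : ℕ) : ℝ)
  obtain ⟨L, s, hs⟩ := exists_firstCoins_sampler (c.sampleLaw (Fin n) μ) (A := bad) fun X =>
    c.measureReal_bad_lt S hZ (fun _ _ => natCast_eq_zero_or_one_le _)
      (sum_aggregate_pos X.2) (hsum_le X.1)
  refine ⟨c.protocol S Z hS s enc hlen dec, fun X hX => ?_, ?_⟩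
  · calc (3 / 4 : ℝ) ≤ 1 - coinLaw.real {ω | s (firstCoins L ω) ∈ bad ⟨X, hX⟩} := by
          linarith [hs ⟨X, hX⟩]
      _ = coinLaw.real {ω | s (firstCoins L ω) ∈ bad ⟨X, hX⟩}ᶜ :=
          (probReal_compl_eq_one_sub (measurableSet_firstCoins fun σ => s σ ∈ bad ⟨X, hX⟩)).symm
      _ ≤ _ := measureReal_mono fun ω hω =>
          c.abs_output_sub_shannonEntropy_le S hZ hS s hlen hdec hX (hsum_le X) hω
  · refine (maxCommunication_convergecast_le S hS enc hlen dec _ _).trans_eq ?_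
    rw [Fintype.card_option, Fintype.card_fin]

end EntropyParameters

/-! ### Choice of the parameters -/

section Logarithms

theorem one_le_log_of_three_le {x : ℝ} (hx : 3 ≤ x) : 1 ≤ Real.log x := by
  rw [Real.le_log_iff_exp_le (by linarith)]
  linarith [Real.exp_one_lt_d9]

theorem log_log_three_pos : 0 < Real.log (Real.log 3) := by
  refine Real.log_pos ?_
  rw [Real.lt_log_iff_exp_lt (by norm_num)]
  linarith [Real.exp_one_lt_d9]

theorem log_log_three_le {x : ℝ} (hx : 3 ≤ x) : Real.log (Real.log 3) ≤ Real.log (Real.log x) :=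
  Real.log_le_log (zero_lt_one.trans_le (one_le_log_of_three_le le_rfl))
    (Real.log_le_log (by norm_num) hx)

theorem log_le_natCast_of_le_pow {y : ℝ} {k : ℕ} (hy : 0 < y) (h : y ≤ 2.7182818283 ^ k) :
    Real.log y ≤ k := by
  rw [Real.log_le_iff_le_exp hy, ← Real.exp_one_pow]
  exact h.trans (pow_le_pow_left₀ (by norm_num) Real.exp_one_gt_d9.le k)

theorem log_le_self_of_pos {x : ℝ} (hx : 0 < x) : Real.log x ≤ x :=
  (Real.log_le_sub_one_of_pos hx).trans (sub_le_self x zero_le_one)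

theorem half_le_log_one_add {γ : ℝ} (hγ₀ : 0 < γ) (hγ₁ : γ ≤ 1) : γ / 2 ≤ Real.log (1 + γ) := by
  have hinv : (1 + γ)⁻¹ ≤ 1 - γ / 2 := by
    rw [inv_le_iff_one_le_mul₀ (by linarith)]
    nlinarith
  linarith [Real.one_sub_inv_le_log_of_pos (show 0 < 1 + γ by linarith)]

theorem le_one_add_pow {γ R : ℝ} {E : ℕ} (hγ₀ : 0 < γ) (hγ₁ : γ ≤ 1) (hR : 0 < R)
    (h : 2 * Real.log R / γ ≤ E) : R ≤ (1 + γ) ^ E := by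
  rw [← Real.log_le_log_iff hR (by positivity), Real.log_pow]
  calc Real.log R ≤ E * (γ / 2) := by linarith [(div_le_iff₀ hγ₀).1 h]
    _ ≤ E * Real.log (1 + γ) := by
        gcongr
        exact half_le_log_one_add hγ₀ hγ₁

theorem log_le_mul_log_of_le_mul_rpow {K c x y : ℝ} (hx : 3 ≤ x) (hy : 1 ≤ y)
    (h : y ≤ K * x ^ c) : Real.log y ≤ (|Real.log K| + |c|) * Real.log x := by
  have hlogx : 1 ≤ Real.log x := one_le_log_of_three_le hx
  have hxc : 0 < x ^ c := Real.rpow_pos_of_pos (by linarith) c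
  have hK : 0 < K := (mul_pos_iff_of_pos_right hxc).1 (by linarith)
  calc Real.log y ≤ Real.log (K * x ^ c) := Real.log_le_log (by linarith) h
    _ = Real.log K + c * Real.log x := by
        rw [Real.log_mul hK.ne' hxc.ne', Real.log_rpow (by linarith)]
    _ ≤ |Real.log K| * Real.log x + |c| * Real.log x := by
        gcongr
        · exact (le_abs_self _).trans (le_mul_of_one_le_right (abs_nonneg _) hlogx)
        · exact le_abs_self c
    _ = (|Real.log K| + |c|) * Real.log x := (add_mul _ _ _).symm

theorem exists_log_log_mul_mul_le (K c : ℝ) : ∃ D : ℝ, 1 ≤ D ∧ ∀ {x y z : ℝ},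
    3 ≤ x → 1 ≤ y → 1 ≤ z → y ≤ K * x ^ c → z ≤ K * x ^ c →
      Real.log (Real.log (x * y * z)) ≤ D * Real.log (Real.log x) := by
  set B := 1 + 2 * (|Real.log K| + |c|)
  have hB : 1 ≤ B := le_add_of_nonneg_right (by positivity)
  have hlogB : 0 ≤ Real.log B := Real.log_nonneg hB
  have hloglog := log_log_three_pos
  refine ⟨1 + Real.log B / Real.log (Real.log 3), le_add_of_nonneg_right (by positivity),
    fun {x y z} hx hy hz hyK hzK => ?_⟩
  have hlogx : 1 ≤ Real.log x := one_le_log_of_three_le hx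
  have hlog : Real.log (x * y * z) ≤ B * Real.log x := by
    rw [Real.log_mul (by positivity) (by positivity), Real.log_mul (by positivity) (by positivity)]
    linarith [log_le_mul_log_of_le_mul_rpow hx hy hyK, log_le_mul_log_of_le_mul_rpow hx hz hzK]
  have hprod : 3 ≤ x * y * z := by
    rw [mul_assoc]
    exact hx.trans (le_mul_of_one_le_right (by linarith) (one_le_mul_of_one_le_of_one_le hy hz))
  calc Real.log (Real.log (x * y * z)) ≤ Real.log (B * Real.log x) :=
        Real.log_le_log (by linarith [one_le_log_of_three_le hprod]) hlog
    _ = Real.log B + Real.log (Real.log x) := Real.log_mul (by positivity) (by positivity)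
    _ ≤ Real.log B / Real.log (Real.log 3) * Real.log (Real.log x) + Real.log (Real.log x) := by
        gcongr
        rw [div_mul_eq_mul_div, le_div_iff₀ hloglog]
        exact mul_le_mul_of_nonneg_left (log_log_three_le hx) hlogB
    _ = (1 + Real.log B / Real.log (Real.log 3)) * Real.log (Real.log x) := by ring

end Logarithms

namespace EntropyParameters

/-- The number of sketches for accuracy of order `1 / x`. -/
def sketchCount (x : ℝ) : ℕ := ⌈100 * x ^ 2⌉₊

/-- The number of bits per register for accuracy of order `1 / x`, when `l` is the logarithm of the
`ℓ¹`-norm. -/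
def registerBits (x l : ℝ) : ℕ := ⌈Real.logb 2 (10 ^ 7 * x ^ 7 * l ^ 3 + 1)⌉₊

section Choice

variable {N x l : ℝ}

theorem le_sketchCount : 100 * x ^ 2 ≤ sketchCount x := Nat.le_ceil _

theorem sketchCount_le : (sketchCount x : ℝ) ≤ 100 * x ^ 2 + 1 :=
  (Nat.ceil_lt_add_one (by positivity)).le

theorem le_two_pow_registerBits_sub_one (hx : 0 ≤ x) (hl : 0 ≤ l) :
    10 ^ 7 * x ^ 7 * l ^ 3 ≤ ((2 ^ registerBits x l - 1 : ℕ) : ℝ) := by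
  have hlog : Real.logb 2 (10 ^ 7 * x ^ 7 * l ^ 3 + 1) ≤ registerBits x l := Nat.le_ceil _
  rw [Real.logb_le_iff_le_rpow one_lt_two (by positivity), Real.rpow_natCast] at hlog
  rw [Nat.cast_pred (by positivity), Nat.cast_pow, Nat.cast_ofNat]
  linarith

theorem registerBits_le (hx : 1 ≤ x) (hl : 1 ≤ l) :
    (registerBits x l : ℝ) ≤ 35 + 14 * Real.log x + 6 * Real.log l := by
  set Y := 10 ^ 7 * x ^ 7 * l ^ 3 + 1
  have hlog2 : 1 / 2 ≤ Real.log 2 := by linarith [Real.log_two_gt_d9]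
  have hY : 1 ≤ Y := le_add_of_nonneg_left (by positivity)
  have hprod : 1 ≤ x ^ 7 * l ^ 3 :=
    one_le_mul_of_one_le_of_one_le (one_le_pow₀ hx) (one_le_pow₀ hl)
  have hlogY : Real.log Y ≤ 17 + (7 * Real.log x + 3 * Real.log l) :=
    calc Real.log Y ≤ Real.log (2 * 10 ^ 7 * (x ^ 7 * l ^ 3)) :=
          Real.log_le_log (by positivity) (by linarith)
      _ = Real.log (2 * 10 ^ 7) + (7 * Real.log x + 3 * Real.log l) := by
          rw [Real.log_mul (by norm_num) (by positivity),
            Real.log_mul (x := x ^ 7) (by positivity) (by positivity), Real.log_pow, Real.log_pow]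
          norm_cast
      _ ≤ _ := by
          gcongr
          exact_mod_cast log_le_natCast_of_le_pow (k := 17) (by positivity) (by norm_num)
  have hlogb : Real.logb 2 Y ≤ 2 * Real.log Y := by
    rw [Real.logb, div_le_iff₀ (by linarith)]
    nlinarith [Real.log_nonneg hY]
  have hceil : (registerBits x l : ℝ) < Real.logb 2 Y + 1 :=
    Nat.ceil_lt_add_one (Real.logb_nonneg one_lt_two hY)
  linarith

theorem log_add_log_le (hx : 40 ≤ x) (hN : 1 ≤ Real.log N) :
    Real.log N + Real.log (2 / (1 / x)) + 1 + Real.log (1 / (1 / x)) ≤ 4 * x * Real.log N := by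
  have hlog_two_mul := log_le_self_of_pos (show 0 < 2 * x by linarith)
  have hlogx := log_le_self_of_pos (show 0 < x by linarith)
  rw [one_div_one_div, div_div_eq_mul_div, div_one]
  nlinarith

theorem forty_mul_sketches_le (hx : 40 ≤ x) (hN : 3 ≤ N) :
    40 * (sketchCount x * (N * (Real.log (2 * N / (1 / x) ^ 2) / (1 / x)))) ≤
      8080 * x ^ 5 * N ^ 2 := by
  have hk : (sketchCount x : ℝ) ≤ 101 * x ^ 2 := sketchCount_le.trans (by nlinarith)
  have hquotient : 2 * N / (1 / x) ^ 2 = 2 * N * x ^ 2 := by field_simp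
  have hlog : Real.log (2 * N * x ^ 2) ≤ 2 * N * x ^ 2 := log_le_self_of_pos (by positivity)
  rw [hquotient, div_div_eq_mul_div, div_one]
  calc 40 * (sketchCount x * (N * (Real.log (2 * N * x ^ 2) * x)))
      ≤ 40 * (sketchCount x * (N * (2 * N * x ^ 2 * x))) := by gcongr
    _ ≤ 40 * (101 * x ^ 2 * (N * (2 * N * x ^ 2 * x))) := by gcongr
    _ = 8080 * x ^ 5 * N ^ 2 := by ring

theorem sketchCount_add_one_le (hx : 40 ≤ x) : (sketchCount x : ℝ) + 1 ≤ 102 * x ^ 2 := by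
  nlinarith [sketchCount_le (x := x)]

theorem sketchCount_add_one_mul_le {m : ℕ} (hx : 40 ≤ x) (hN : 3 ≤ N) (hm : m ≤ N) :
    (sketchCount x + 1) * (m * (8080 * x ^ 5 * N ^ 2) / (4 * 10 ^ 7 * x ^ 7 * N ^ 3)) ≤
      1 / 40 := by
  rw [mul_div_assoc', div_le_iff₀ (by positivity)]
  calc ((sketchCount x : ℝ) + 1) * (m * (8080 * x ^ 5 * N ^ 2))
      ≤ 102 * x ^ 2 * (N * (8080 * x ^ 5 * N ^ 2)) := by
        gcongr
        exact sketchCount_add_one_le hx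
    _ = 824160 * (x ^ 7 * N ^ 3) := by ring
    _ ≤ 10 ^ 6 * (x ^ 7 * N ^ 3) := by gcongr; norm_num
    _ = 1 / 40 * (4 * 10 ^ 7 * x ^ 7 * N ^ 3) := by ring

theorem log_four_mul_ten_pow_mul_le (hx : 40 ≤ x) (hN : 3 ≤ N) :
    Real.log (4 * 10 ^ 7 * x ^ 7 * N ^ 3) ≤ 8 * x * Real.log N := by
  have hlogN : 1 ≤ Real.log N := one_le_log_of_three_le hN
  have hlogx := log_le_self_of_pos (show 0 < x by linarith)
  have hconst : Real.log (4 * 10 ^ 7) ≤ 18 :=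
    mod_cast log_le_natCast_of_le_pow (k := 18) (by positivity) (by norm_num)
  rw [Real.log_mul (by positivity) (by positivity), Real.log_mul (by positivity) (by positivity),
    Real.log_pow, Real.log_pow, Nat.cast_ofNat, Nat.cast_ofNat]
  nlinarith

theorem le_one_add_pow_two_pow_registerBits (hx : 40 ≤ x) (hN : 3 ≤ N) :
    4 * 10 ^ 7 * x ^ 7 * N ^ 3 ≤
      (1 + 1 / (6 * 10 ^ 5 * x ^ 6 * Real.log N ^ 2)) ^ (2 ^ registerBits x (Real.log N) - 1) := by
  have hlogN : 1 ≤ Real.log N := one_le_log_of_three_le hN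
  have hprod : 1 ≤ x ^ 6 * Real.log N ^ 2 :=
    one_le_mul_of_one_le_of_one_le (one_le_pow₀ (by linarith)) (one_le_pow₀ hlogN)
  refine le_one_add_pow (by positivity) ?_ (by positivity) ?_
  · rw [div_le_one (by positivity)]
    linarith
  · rw [div_div_eq_mul_div, div_one]
    calc 2 * Real.log (4 * 10 ^ 7 * x ^ 7 * N ^ 3) * (6 * 10 ^ 5 * x ^ 6 * Real.log N ^ 2)
        ≤ 2 * (8 * x * Real.log N) * (6 * 10 ^ 5 * x ^ 6 * Real.log N ^ 2) := by
          gcongr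
          exact log_four_mul_ten_pow_mul_le hx hN
      _ = 96 * 10 ^ 5 * (x ^ 7 * Real.log N ^ 3) := by ring
      _ ≤ 10 ^ 7 * (x ^ 7 * Real.log N ^ 3) := by gcongr; norm_num
      _ = 10 ^ 7 * x ^ 7 * Real.log N ^ 3 := by ring
      _ ≤ _ := le_two_pow_registerBits_sub_one (by linarith) (by linarith)

/-- Parameters for accuracy of order `1 / x`. The bound `R` on the partial sums is polynomial in `N`
and the base `1 + γ` of the rounding is `1 + 1 / poly (log N)`, so the exponents are polynomial in
`log N` and fit into `O(log log N)` bits. -/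
def ofAccuracy {m : ℕ} (hx : 40 ≤ x) (hN : 3 ≤ N) (hm : m ≤ N) : EntropyParameters N m :=
  have hlogN : 1 ≤ Real.log N := one_le_log_of_three_le hN
  { τ := 1 / x
    L := 4 * x * Real.log N
    η := 1 / (12 * x ^ 2 * Real.log N)
    γ := 1 / (6 * 10 ^ 5 * x ^ 6 * Real.log N ^ 2)
    T := 8080 * x ^ 5 * N ^ 2
    R := 4 * 10 ^ 7 * x ^ 7 * N ^ 3
    k := sketchCount x
    b := registerBits x (Real.log N)
    one_le_N := by linarith
    τ_pos := by positivity
    τ_le := one_div_le_one_div_of_le (by norm_num) hx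
    η_pos := by positivity
    γ_pos := by positivity
    R_pos := by positivity
    one_le_L := by nlinarith
    le_L := log_add_log_le hx hlogN
    η_mul_L_le := by
      refine le_of_eq ?_
      field_simp
      norm_num
    le_k := by
      rw [one_div, inv_pow, div_inv_eq_mul]
      exact le_sketchCount
    γ_div_le := by
      have hquotient : 1 / (6 * 10 ^ 5 * x ^ 6 * Real.log N ^ 2) /
          (1 / (12 * x ^ 2 * Real.log N)) ^ 2 = 144 / (6 * 10 ^ 5 * x ^ 2) := by
        field_simp
        norm_num
      rw [hquotient, ← mul_div_assoc, div_le_iff₀ (by positivity)]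
      linarith [sketchCount_add_one_le hx, sq_nonneg x]
    N_le_T := by
      have hpow : 1 ≤ x ^ 5 := one_le_pow₀ (by linarith)
      nlinarith [le_mul_of_one_le_left (sq_nonneg N) hpow]
    le_T := forty_mul_sketches_le hx hN
    T_div_le := sketchCount_add_one_mul_le hx hN hm
    R_le := le_one_add_pow_two_pow_registerBits hx hN }

end Choice

end EntropyParameters

section Main

variable {n m M : ℕ} {G : SimpleGraph (Fin m)}

theorem EstimatesEntropy.mono {P : Protocol G (Fin n → Fin (M + 1))} {ε ε' : ℝ}
    (h : EstimatesEntropy P ε) (hε : ε ≤ ε') : EstimatesEntropy P ε' := fun X hX =>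
  (h X hX).trans (measureReal_mono fun _ hω => hω.trans hε)

theorem sketchCount_mul_registerBits_le {ε N : ℝ} (hε₀ : 0 < ε) (hε₁ : ε ≤ 1) (hN : 3 ≤ N) :
    ((EntropyParameters.sketchCount (40 / ε) : ℝ) + 1) *
        EntropyParameters.registerBits (40 / ε) (Real.log N) ≤
      163200 * (91 / Real.log (Real.log 3) + 20) *
        ((1 / ε ^ 2) * (Real.log (Real.log N) + Real.log (1 / ε))) := by
  set c₀ := Real.log (Real.log 3)
  have hc₀ : 0 < c₀ := log_log_three_pos
  have hloglog : c₀ ≤ Real.log (Real.log N) := log_log_three_le hN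
  have hlogε : 0 ≤ Real.log (1 / ε) := Real.log_nonneg (one_le_one_div hε₀ hε₁)
  have hx : 40 ≤ 40 / ε := le_div_self (by norm_num) hε₀ hε₁
  have hlogx : Real.log (40 / ε) ≤ 4 + Real.log (1 / ε) := by
    rw [div_eq_mul_one_div, Real.log_mul (by norm_num) (by positivity)]
    gcongr
    exact_mod_cast log_le_natCast_of_le_pow (k := 4) (by positivity) (by norm_num)
  have hconst : 91 ≤ 91 / c₀ * Real.log (Real.log N) := by
    rw [div_mul_eq_mul_div, le_div_iff₀ hc₀]
    gcongr
  have hbits : (EntropyParameters.registerBits (40 / ε) (Real.log N) : ℝ) ≤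
      (91 / c₀ + 20) * (Real.log (Real.log N) + Real.log (1 / ε)) := by
    have hregisterBits := EntropyParameters.registerBits_le (by linarith : 1 ≤ 40 / ε)
      (one_le_log_of_three_le hN)
    have hnonneg : 0 ≤ 91 / c₀ * Real.log (1 / ε) := by positivity
    linarith
  calc _ ≤ 102 * (40 / ε) ^ 2 *
        ((91 / c₀ + 20) * (Real.log (Real.log N) + Real.log (1 / ε))) := by
        gcongr
        exact EntropyParameters.sketchCount_add_one_le hx
    _ = _ := by
        field_simp
        ring

theorem exists_protocol_log_log : ∃ C : ℝ, 0 ≤ C ∧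
    ∀ (n m M : ℕ) (ε : ℝ) (G : SimpleGraph (Fin m)), 3 ≤ n * m * M → 0 < ε → ε < 1 → G.Connected →
      ∃ P : Protocol G (Fin n → Fin (M + 1)), EstimatesEntropy P ε ∧
        (P.maxCommunication : ℝ) ≤
          C * ((1 / ε ^ 2) * (Real.log (Real.log ((n : ℝ) * m * M)) + Real.log (1 / ε))) := by
  have hc₀ := log_log_three_pos
  refine ⟨2 * (163200 * (91 / Real.log (Real.log 3) + 20)), by positivity,
    fun n m M ε G h3 hε₀ hε₁ hG => ?_⟩
  have hN : (3 : ℝ) ≤ n * m * M := mod_cast h3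
  have hm : m ≤ n * m * M := by
    have hpos : 0 < n * m * M := by linarith
    rw [mul_right_comm] at hpos ⊢
    exact Nat.le_mul_of_pos_left m (Nat.pos_of_mul_pos_right hpos)
  have hx : 40 ≤ 40 / ε := le_div_self (by norm_num) hε₀ hε₁.le
  let c : EntropyParameters ((n : ℝ) * m * M) m := .ofAccuracy hx hN (mod_cast hm)
  obtain ⟨P, hP, hcomm⟩ := c.exists_protocol (n := n) (M := M) hG le_rfl
  have hτ : 8 * c.τ ≤ ε := by
    calc 8 * (1 / (40 / ε)) = ε / 5 := by field_simp; norm_num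
      _ ≤ ε := by linarith
  refine ⟨P, hP.mono hτ, ?_⟩
  calc (P.maxCommunication : ℝ) ≤ 2 * ((c.k + 1) * c.b) := mod_cast hcomm
    _ ≤ 2 * _ :=
        mul_le_mul_of_nonneg_left (sketchCount_mul_registerBits_le hε₀ hε₁.le hN) zero_le_two
    _ = _ := (mul_assoc _ _ _).symm

/-- The protocol without communication that always outputs `0`. -/
def silentProtocol {V I : Type} [Fintype V] (G : SimpleGraph V) (v : V) : Protocol G I where
  rounds := 0
  len := fun _ _ _ => 0
  len_eq_zero := fun _ _ _ _ => rfl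
  msg := fun _ _ _ _ _ _ => []
  length_msg := fun _ _ _ _ _ _ => rfl
  measurableSet_msg := fun _ _ _ _ _ _ => MeasurableSet.const _
  center := v
  out := fun _ _ _ => 0
  measurable_out := fun _ _ => measurable_const

theorem maxCommunication_silentProtocol {V I : Type} [Fintype V] (G : SimpleGraph V) (v : V) :
    (silentProtocol G v : Protocol G I).maxCommunication = 0 := by
  simp [silentProtocol, Protocol.maxCommunication, Protocol.edgeBits]

theorem estimatesEntropy_of_max_entry_zero (P : Protocol G (Fin n → Fin (0 + 1))) (ε : ℝ) :
    EstimatesEntropy P ε := fun X hX =>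
  absurd (funext fun j => Finset.sum_eq_zero fun i _ => by simp) hX

end Main

end MessagePassing

end

theorem theorem5p3 :
    -- inputs and networks of arbitrary size
    (∃ C : ℝ, ∀ (n m M : ℕ) (ε : ℝ) (G : SimpleGraph (Fin m)),
      3 ≤ n * m * M → 0 < ε → ε < 1 → G.Connected →
        ∃ P : MessagePassing.Protocol G (Fin n → Fin (M + 1)),
          MessagePassing.EstimatesEntropy P ε ∧
          (P.maxCommunication : ℝ) ≤
            C * ((1 / ε ^ 2) * (Real.log (Real.log ((n : ℝ) * m * M)) + Real.log (1 / ε)))) ∧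
    -- number of players and size of the entries polynomial in the dimension
    (∀ K c : ℝ, ∃ C : ℝ, ∀ (n m M : ℕ) (ε : ℝ) (G : SimpleGraph (Fin m)),
      3 ≤ n → (m : ℝ) ≤ K * (n : ℝ) ^ c → (M : ℝ) ≤ K * (n : ℝ) ^ c →
      0 < ε → ε < 1 → G.Connected →
        ∃ P : MessagePassing.Protocol G (Fin n → Fin (M + 1)),
          MessagePassing.EstimatesEntropy P ε ∧
          (P.maxCommunication : ℝ) ≤
            C * ((1 / ε ^ 2) * (Real.log (Real.log n) + Real.log (1 / ε)))) := by
  obtain ⟨C, hC₀, hC⟩ := MessagePassing.exists_protocol_log_log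
  refine ⟨⟨C, hC⟩, fun K c => ?_⟩
  obtain ⟨D, hD₁, hD⟩ := MessagePassing.exists_log_log_mul_mul_le K c
  refine ⟨C * D, fun n m M ε G hn hm hM hε₀ hε₁ hG => ?_⟩
  obtain ⟨v⟩ := hG.nonempty
  have hn₃ : (3 : ℝ) ≤ n := mod_cast hn
  have hloglog : 0 < Real.log (Real.log n) :=
    MessagePassing.log_log_three_pos.trans_le (MessagePassing.log_log_three_le hn₃)
  have hlogε : 0 ≤ Real.log (1 / ε) := Real.log_nonneg (one_le_one_div hε₀ hε₁.le)
  rcases Nat.eq_zero_or_pos M with rfl | hM₁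
  · refine ⟨MessagePassing.silentProtocol G v,
      MessagePassing.estimatesEntropy_of_max_entry_zero _ ε, ?_⟩
    rw [MessagePassing.maxCommunication_silentProtocol, Nat.cast_zero]
    positivity
  · have hprod : 3 ≤ n * m * M :=
      hn.trans (mul_assoc n m M ▸ Nat.le_mul_of_pos_right n (Nat.mul_pos v.pos hM₁))
    obtain ⟨P, hP, hcomm⟩ := hC n m M ε G hprod hε₀ hε₁ hG
    refine ⟨P, hP, hcomm.trans ?_⟩
    rw [mul_assoc C D, mul_left_comm D, mul_add D]
    gcongr
    · exact hD hn₃ (mod_cast v.pos) (mod_cast hM₁) hm hM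
    · exact le_mul_of_one_le_left hlogε hD₁
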